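/- Let $p\geq 1$ and let $L(p,1)=S^3/\mathbb{Z}_p$ be the quotient of $S^3\subset\mathbb{C}^2$ by the diagonal action of the $p$-th roots of unity, with the orientation induced from $S^3$. The standard positive Hopf link in $L(p,1)$ is formed by the images $H_0,H_1$ of the oriented coordinate circles $\{(e^{i\theta},0)\}$ and $\{(0,e^{i\theta})\}$ (each traversed once in $L(p,1)$); these are the spines of the genus $1$ Heegaard decomposition of $L(p,1)$, with rational linking number $1/p$. A positive Hopf link $L_0\sqcup L_1$ in $L(p,1)$ is the image of $H_0\sqcup H_1$ under an orientation-preserving diffeomorphism of $L(p,1)$. Let $\xi=\ker\alpha$ be any (coorientable) contact structure on $L(p,1)$, tight or overtwisted, let $L_0\sqcup L_1$ be a Hopf link, and let $i\in\{0,1\}$ be such that $L_i$ is Legendrian, that is, tangent to $\xi$. The rational Thurston--Bennequin invariant $\mathtt{tb}_{\mathbb{Q}}(L_i)$ is the rational linking number of $L_i$ and a push-off $L_i'$ of $L_i$ in a direction tangent to $\xi$ and transverse to $L_i$. Here the rational linking number of disjoint oriented closed curves $J,K$ is $\frac{1}{r}(\Sigma\bullet K)$, where $\Sigma$ is a rational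 Seifert surface, i.e. an integral $2$-chain with $\partial\Sigma=rJ$ for some $r>0$ that is transverse to $K$, and $\Sigma\bullet K$ is the intersection number. Then $\mathtt{tb}_{\mathbb{Q}}(L_i)$ is well defined, i.e. these choices exist and its value does not depend on them, and there is an integer $\mathtt{t}_i$ such that \[ \mathtt{tb}_{\mathbb{Q}}(L_i)=\mathtt{t}_i+\frac{1}{p}. \] -/

import Mathlib

open scoped Manifold ContDiff

noncomputable section

namespace LensHopf

/-! ### The lens space `L(p,1)` as a smooth oriented manifold -/

/-- The vector space `ℂ²`. -/
abbrev C2 : Type := EuclideanSpace ℂ (Fin 2)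

instance finrank_C2 : Fact (Module.finrank ℝ C2 = 3 + 1) :=
  ⟨by rw [finrank_real_of_complex, finrank_euclideanSpace, Fintype.card_fin]⟩

/-- The unit sphere `S³ ⊂ ℂ²`. -/
abbrev S3 : Type := Metric.sphere (0 : C2) 1

/-- The group of complex `p`-th roots of unity. -/
abbrev Roots (p : ℕ) : Subgroup Circle := (powMonoidHom p : Circle →* Circle).ker

/-- Roots of unity act on `S³` by scalar multiplication, `u • (z, w) = (u z, u w)`. -/
instance (p : ℕ) : MulAction (Roots p) S3 where
  smul u x := ⟨((u : Circle) : ℂ) • (x : C2), by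
    rw [mem_sphere_zero_iff_norm, norm_smul, Circle.norm_coe, one_mul, norm_eq_of_mem_sphere]⟩
  one_smul x := Subtype.ext (one_smul ℂ (x : C2))
  mul_smul u v x := Subtype.ext (mul_smul ((u : Circle) : ℂ) ((v : Circle) : ℂ) (x : C2))

theorem coe_smul {p : ℕ} (u : Roots p) (x : S3) :
    ((u • x : S3) : C2) = ((u : Circle) : ℂ) • (x : C2) := rfl

instance (p : ℕ) [NeZero p] : Finite (Roots p) := by
  have hinj : Function.Injective
      (fun u : Roots p => (⟨((u : Circle) : ℂ), by
        have h := congrArg (fun c : Circle => (c : ℂ)) (MonoidHom.mem_ker.1 u.2)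
        rw [Polynomial.mem_nthRoots (NeZero.pos p)]
        simpa using h⟩ : {z : ℂ // z ∈ Polynomial.nthRoots p (1 : ℂ)})) := by
    intro u v h
    have h' := congrArg Subtype.val h
    exact Subtype.ext (Circle.ext h')
  exact Finite.of_injective _ hinj

instance (p : ℕ) : IsCancelSMul (Roots p) S3 where
  left_cancel' u x y h := by simpa using h
  right_cancel' u v x h := by
    have h1 : ((u : Circle) : ℂ) • (x : C2) = ((v : Circle) : ℂ) • (x : C2) :=
      congrArg Subtype.val h
    have hx : (x : C2) ≠ 0 := ne_zero_of_mem_unit_sphere x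
    exact Subtype.ext (Circle.ext (smul_left_injective ℂ hx h1))

instance (p : ℕ) : ContinuousConstSMul (Roots p) S3 where
  continuous_const_smul u :=
    (continuous_subtype_val.const_smul ((u : Circle) : ℂ)).subtype_mk _

instance (p : ℕ) [NeZero p] : ProperlyDiscontinuousSMul (Roots p) S3 where
  finite_disjoint_inter_image _ _ := Set.toFinite _

/-- The lens space `L(p,1)`, the quotient of `S³` by the diagonal action of the `p`-th roots of
unity.  Its charts are the charts of `S³` composed with local sections of the projection. -/
abbrev LensSpace (p : ℕ) [NeZero p] : Type := MulAction.orbitRel.Quotient (Roots p) S3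

/-- The projection `S³ → L(p,1)`. -/
def proj (p : ℕ) [NeZero p] (x : S3) : LensSpace p := Quotient.mk _ x

theorem proj_smul (p : ℕ) [NeZero p] (u : Roots p) (x : S3) : proj p (u • x) = proj p x :=
  Quotient.sound ⟨u, rfl⟩

theorem exists_smul_eq (p : ℕ) [NeZero p] {x y : S3} (h : proj p x = proj p y) : ∃ u : Roots p, u • y = x :=
  Quotient.exact h

theorem isLocalHomeomorph_proj (p : ℕ) [NeZero p] : IsLocalHomeomorph (proj p) :=
  (isQuotientCoveringMap_quotientMk_of_properlyDiscontinuousSMul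
    (G := Roots p) (E := S3)).isCoveringMap.isLocalHomeomorph

theorem contMDiff_smul (p : ℕ) (u : Roots p) : ContMDiff (𝓡 3) (𝓡 3) ω (fun x : S3 => u • x) := by
  have h : ContMDiff (𝓡 3) 𝓘(ℝ, C2) ω (fun x : S3 => ((u : Circle) : ℂ) • (x : C2)) := by
    have h1 : ContDiff ℝ ω (fun x : C2 => ((u : Circle) : ℂ) • x) :=
      contDiff_const_smul ((u : Circle) : ℂ)
    exact h1.contMDiff.comp contMDiff_coe_sphere
  exact h.codRestrict_sphere (n := 3) _

/-- A local section of the projection, composed with the projection, is locally the action of an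
element of the group. -/
theorem localInverse_proj (p : ℕ) [NeZero p] (b x₀ : S3)
    (h : proj p x₀ ∈ ((isLocalHomeomorph_proj p).localInverseAt b).source) :
    ∃ u : Roots p, ∀ᶠ x in nhds x₀,
      (isLocalHomeomorph_proj p).localInverseAt b (proj p x) = u • x := by
  set σ := (isLocalHomeomorph_proj p).localInverseAt b with hσ
  have h1 : proj p (σ (proj p x₀)) = proj p x₀ :=
    (isLocalHomeomorph_proj p).apply_localInverseAt_of_mem h
  obtain ⟨u, hu⟩ := exists_smul_eq p h1
  refine ⟨u, ?_⟩
  have hmem : u • x₀ ∈ σ.target := hu ▸ σ.map_source h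
  have hc : Filter.Tendsto (fun x : S3 => u • x) (nhds x₀) (nhds (u • x₀)) :=
    (continuous_const_smul u).continuousAt
  filter_upwards [hc (σ.open_target.mem_nhds hmem)] with x hx
  have h2 := σ.right_inv hx
  rw [(isLocalHomeomorph_proj p).localInverseAt_symm, proj_smul] at h2
  exact h2

instance (p : ℕ) [NeZero p] : IsManifold (𝓡 3) ∞ (LensSpace p) := by
  have hsurj : Function.Surjective
      (Quotient.mk (MulAction.orbitRel (Roots p) S3)) := Quotient.mk_surjective
  apply isManifold_of_contDiffOn
  rintro e e' ⟨q, rfl⟩ ⟨q', rfl⟩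
  generalize (Function.Surjective.hasRightInverse hsurj).choose q = a
  generalize (Function.Surjective.hasRightInverse hsurj).choose q' = b
  change ContDiffOn ℝ ∞ ((𝓡 3) ∘ ((((isLocalHomeomorph_proj p).localInverseAt a).trans
    (chartAt (EuclideanSpace ℝ (Fin 3)) a)).symm.trans
    (((isLocalHomeomorph_proj p).localInverseAt b).trans
    (chartAt (EuclideanSpace ℝ (Fin 3)) b))) ∘ (𝓡 3).symm) _
  rintro y ⟨hy, -⟩
  simp only [OpenPartialHomeomorph.trans_source, OpenPartialHomeomorph.symm_source,
    OpenPartialHomeomorph.trans_symm_eq_symm_trans_symm, OpenPartialHomeomorph.coe_trans,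
    IsLocalHomeomorph.localInverseAt_symm, Set.mem_preimage, Set.mem_inter_iff,
    Function.comp_apply, modelWithCornersSelf_coe_symm, id_eq] at hy
  obtain ⟨⟨hya, -⟩, hyb, hyc⟩ := hy
  set φ := chartAt (EuclideanSpace ℝ (Fin 3)) a
  set ψ := chartAt (EuclideanSpace ℝ (Fin 3)) b
  set σ := (isLocalHomeomorph_proj p).localInverseAt b
  obtain ⟨u, hu⟩ := localInverse_proj p b (φ.symm y) hyb
  have hφ : ContMDiffAt (𝓡 3) (𝓡 3) ∞ φ.symm y :=
    (contMDiffOn_chart_symm (I := 𝓡 3) (n := ∞) (x := a)).contMDiffAt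
      (φ.open_target.mem_nhds hya)
  have hψ : ContMDiffAt (𝓡 3) (𝓡 3) ∞ ψ (u • φ.symm y) :=
    (contMDiffOn_chart (I := 𝓡 3) (n := ∞) (x := b)).contMDiffAt
      (ψ.open_source.mem_nhds (hu.self_of_nhds ▸ hyc))
  have hcomp : ContMDiffAt (𝓡 3) (𝓡 3) ∞ (fun z => ψ (u • φ.symm z)) y :=
    ContMDiffAt.comp y hψ
      (ContMDiffAt.comp y (((contMDiff_smul p u).of_le le_top).contMDiffAt) hφ)
  have heq : (fun z => ψ (σ (proj p (φ.symm z)))) =ᶠ[nhds y] fun z => ψ (u • φ.symm z) := by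
    filter_upwards [hφ.continuousAt.eventually hu] with z hz
    rw [hz]
  have h := (hcomp.congr_of_eventuallyEq heq).contDiffAt
  have hfun : (𝓡 3) ∘ ((((isLocalHomeomorph_proj p).localInverseAt a).trans φ).symm.trans
      (σ.trans ψ)) ∘ (𝓡 3).symm = fun z => ψ (σ (proj p (φ.symm z))) := by
    funext z
    simp [OpenPartialHomeomorph.trans_symm_eq_symm_trans_symm]
  rw [hfun]
  exact h.contDiffWithinAt

/-- The projection `S³ → L(p,1)` is smooth. -/
theorem contMDiff_proj (p : ℕ) [NeZero p] : ContMDiff (𝓡 3) (𝓡 3) ∞ (proj p) := by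
  intro x₀
  rw [contMDiffAt_iff_target]
  refine ⟨(isLocalHomeomorph_proj p).continuous.continuousAt, ?_⟩
  have hmem := mem_chart_source (EuclideanSpace ℝ (Fin 3)) (proj p x₀)
  have hex : ∃ b, chartAt (EuclideanSpace ℝ (Fin 3)) (proj p x₀) =
      ((isLocalHomeomorph_proj p).localInverseAt b).trans
        (chartAt (EuclideanSpace ℝ (Fin 3)) b) := ⟨_, rfl⟩
  obtain ⟨b, hb⟩ := hex
  rw [hb] at hmem
  have hmem' : proj p x₀ ∈ ((isLocalHomeomorph_proj p).localInverseAt b).source ∧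
      (isLocalHomeomorph_proj p).localInverseAt b (proj p x₀) ∈
        (chartAt (EuclideanSpace ℝ (Fin 3)) b).source := by
    simpa using hmem
  obtain ⟨u, hu⟩ := localInverse_proj p b x₀ hmem'.1
  have hψ : ContMDiffAt (𝓡 3) (𝓡 3) ∞ (chartAt (EuclideanSpace ℝ (Fin 3)) b) (u • x₀) :=
    (contMDiffOn_chart (I := 𝓡 3) (n := ∞) (x := b)).contMDiffAt
      ((chartAt (EuclideanSpace ℝ (Fin 3)) b).open_source.mem_nhds
        (hu.self_of_nhds ▸ hmem'.2))
  have hcomp : ContMDiffAt (𝓡 3) (𝓡 3) ∞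
      (fun x => chartAt (EuclideanSpace ℝ (Fin 3)) b (u • x)) x₀ :=
    ContMDiffAt.comp x₀ hψ ((contMDiff_smul p u).of_le le_top).contMDiffAt
  refine hcomp.congr_of_eventuallyEq ?_
  filter_upwards [hu] with x hx
  simp [extChartAt, hb, hx]

/-- Real coordinates on `ℂ²`, in the order `(Re z, Im z, Re w, Im w)`. -/
def realCoords (v : C2) : Fin 4 → ℝ := ![(v 0).re, (v 0).im, (v 1).re, (v 1).im]

/-- The orientation of `L(p,1)` induced from `S³`, where `S³` is oriented as the boundary of the
unit ball in `ℂ²` (outward normal first): `v 0, v 1, v 2` is a positive basis of the tangent space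
at `x` if it is the image of tangent vectors `u 0, u 1, u 2` at a point `y` of `S³` over `x` such
that `(y, u 0, u 1, u 2)` is a positive basis of `ℂ²`. -/
def IsPositiveBasis (p : ℕ) [NeZero p] (x : LensSpace p)
    (v : Fin 3 → TangentSpace (𝓡 3) x) : Prop :=
  ∃ (y : S3) (u : Fin 3 → TangentSpace (𝓡 3) y), proj p y = x ∧
    (∀ k, mfderiv (𝓡 3) (𝓡 3) (proj p) y (u k) = v k) ∧
    0 < Matrix.det (Matrix.of (Fin.cons (realCoords (y : C2)) fun k =>
      realCoords (mfderiv (𝓡 3) 𝓘(ℝ, C2) (Subtype.val : S3 → C2) y (u k)) :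
        Fin 4 → Fin 4 → ℝ))

/-- A diffeomorphism of `L(p,1)` that preserves the orientation. -/
def PreservesOrientation (p : ℕ) [NeZero p]
    (φ : LensSpace p ≃ₘ^∞⟮𝓡 3, 𝓡 3⟯ LensSpace p) : Prop :=
  ∀ (x : LensSpace p) (v : Fin 3 → TangentSpace (𝓡 3) x),
    IsPositiveBasis p x v →
      IsPositiveBasis p (φ x) fun k => mfderiv (𝓡 3) (𝓡 3) φ x (v k)

/-! ### Curves and the Hopf link -/

/-- Smooth parametrised curves in `L(p,1)`.  Oriented closed curves are parametrised with
period `1`. -/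
abbrev Curve (p : ℕ) [NeZero p] : Type := C^∞⟮𝓘(ℝ, ℝ), ℝ; 𝓡 3, LensSpace p⟯

/-- The velocity vector of a curve. -/
def velocity {p : ℕ} [NeZero p] (γ : Curve p) (t : ℝ) : TangentSpace (𝓡 3) (γ t) :=
  mfderiv 𝓘(ℝ, ℝ) (𝓡 3) γ t (1 : ℝ)

/-- The components of the standard positive Hopf link in `L(p,1)`: the images of the two
coordinate circles `S³ ∩ (ℂ × 0)` and `S³ ∩ (0 × ℂ)`, oriented by `t ↦ e^{2πit/p}` and traversed
once for `0 ≤ t ≤ 1`.  These are the spines of the two solid tori `|w| ≤ |z|` and `|z| ≤ |w|` in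
`L(p,1)`. -/
def standardHopf (p : ℕ) [NeZero p] (i : Fin 2) (t : ℝ) : LensSpace p :=
  proj p ⟨EuclideanSpace.single i (Circle.exp (2 * Real.pi * t / p) : ℂ), by
    rw [mem_sphere_zero_iff_norm, PiLp.norm_single, Circle.norm_coe]⟩

/-- `L 0 ⊔ L 1` is a (positive, ordered, oriented) Hopf link in `L(p,1)`: the image of the standard
one under an orientation-preserving diffeomorphism. -/
def IsHopfLink (p : ℕ) [NeZero p] (L : Fin 2 → Curve p) : Prop :=
  ∃ φ : LensSpace p ≃ₘ^∞⟮𝓡 3, 𝓡 3⟯ LensSpace p, PreservesOrientation p φ ∧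
    ∀ i t, L i t = φ (standardHopf p i t)

/-! ### Contact structures -/

/-- The expression of a differential `1`-form in the chart around `x`. -/
def localForm {p : ℕ} [NeZero p] (α : ∀ x : LensSpace p, TangentSpace (𝓡 3) x →L[ℝ] ℝ)
    (x : LensSpace p) (y : EuclideanSpace ℝ (Fin 3)) : EuclideanSpace ℝ (Fin 3) →L[ℝ] ℝ :=
  (α ((chartAt (EuclideanSpace ℝ (Fin 3)) x).symm y)).comp
    (mfderiv (𝓡 3) (𝓡 3) (chartAt (EuclideanSpace ℝ (Fin 3)) x).symm y)

/-- `α` is a contact form: a smooth, nowhere zero `1`-form whose exterior derivative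
`dα(v, w) = (D_v α)(w) - (D_w α)(v)` is nondegenerate on `ker α`, that is, `α ∧ dα` vanishes
nowhere. -/
def IsContactForm {p : ℕ} [NeZero p]
    (α : ∀ x : LensSpace p, TangentSpace (𝓡 3) x →L[ℝ] ℝ) : Prop :=
  ∀ x : LensSpace p,
    ContDiffOn ℝ ∞ (localForm α x) (chartAt (EuclideanSpace ℝ (Fin 3)) x).target ∧
    ∀ y ∈ (chartAt (EuclideanSpace ℝ (Fin 3)) x).target,
      localForm α x y ≠ 0 ∧
      ∀ v, localForm α x y v = 0 → v ≠ 0 → ∃ w, localForm α x y w = 0 ∧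
        fderiv ℝ (localForm α x) y v w - fderiv ℝ (localForm α x) y w v ≠ 0

/-- A (coorientable) contact structure on `L(p,1)`: the kernel of a contact form. -/
def IsContactStructure {p : ℕ} [NeZero p]
    (ξ : ∀ x : LensSpace p, Submodule ℝ (TangentSpace (𝓡 3) x)) : Prop :=
  ∃ α : ∀ x : LensSpace p, TangentSpace (𝓡 3) x →L[ℝ] ℝ,
    IsContactForm α ∧ ∀ x v, v ∈ ξ x ↔ α x v = 0

/-- A curve that is everywhere tangent to `ξ`. -/
def IsLegendrian {p : ℕ} [NeZero p]
    (ξ : ∀ x : LensSpace p, Submodule ℝ (TangentSpace (𝓡 3) x)) (L : Curve p) : Prop :=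
  ∀ t, velocity L t ∈ ξ (L t)

/-- `L'` is obtained by pushing the closed curve `L` off itself in a direction that is tangent to
`ξ` and transverse to `L`, i.e. along the contact framing of `L`.  The push-off is the time-`1`
curve of a smooth family of closed curves `F (s, ·)` that starts at `L` and is disjoint from `L`
for `0 < s ≤ 1`. -/
def IsContactPushOff {p : ℕ} [NeZero p]
    (ξ : ∀ x : LensSpace p, Submodule ℝ (TangentSpace (𝓡 3) x)) (L L' : Curve p) : Prop :=
  ∃ F : C^∞⟮𝓘(ℝ, ℝ × ℝ), ℝ × ℝ; 𝓡 3, LensSpace p⟯,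
    (∀ s t, F (s, t + 1) = F (s, t)) ∧
    (∀ t, F (0, t) = L t) ∧
    (∀ t, mfderiv 𝓘(ℝ, ℝ × ℝ) (𝓡 3) F (0, t) ((1, 0) : ℝ × ℝ) ∈ ξ (F (0, t))) ∧
    (∀ t, LinearIndependent ℝ (M := EuclideanSpace ℝ (Fin 3))
      ![velocity L t, mfderiv 𝓘(ℝ, ℝ × ℝ) (𝓡 3) F (0, t) ((1, 0) : ℝ × ℝ)]) ∧
    (∀ s t t', 0 < s → s ≤ 1 → F (s, t) ≠ L t') ∧
    ∀ t, L' t = F (1, t)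

/-! ### Rational Seifert surfaces and rational linking numbers -/

/-- The `i`-th face of the standard `2`-simplex. -/
def face (i : Fin 3) : C(stdSimplex ℝ (Fin 2), stdSimplex ℝ (Fin 3)) :=
  ⟨stdSimplex.map i.succAbove, stdSimplex.continuous_map _⟩

/-- The boundary of an integral singular `2`-chain. -/
def chainBoundary {X : Type} [TopologicalSpace X] (c : C(stdSimplex ℝ (Fin 3), X) →₀ ℤ) :
    C(stdSimplex ℝ (Fin 2), X) →₀ ℤ :=
  c.sum fun σ n => ∑ i : Fin 3, Finsupp.single (σ.comp (face i)) ((-1) ^ (i : ℕ) * n)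

/-- The singular `1`-simplex given by a curve on `[0, 1]`; a cycle if the curve has period `1`. -/
def curveSimplex {X : Type} [TopologicalSpace X] (γ : C(ℝ, X)) : C(stdSimplex ℝ (Fin 2), X) :=
  ⟨fun t => γ (t.1 1), γ.continuous.comp ((continuous_apply 1).comp continuous_subtype_val)⟩

/-- Smooth maps from `ℂ` to `L(p,1)`; the restriction to the closed unit disc is regarded as a
parametrised disc, oriented by `ℂ`. -/
abbrev Disc (p : ℕ) [NeZero p] : Type := C^∞⟮𝓘(ℝ, ℂ), ℂ; 𝓡 3, LensSpace p⟯

/-- The boundary of a disc, traversed once counterclockwise for `0 ≤ t ≤ 1`. -/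
def discBoundary {p : ℕ} [NeZero p] (d : Disc p) : C(ℝ, LensSpace p) :=
  ⟨fun t => d (Circle.exp (2 * Real.pi * t)), by
    have h : Continuous fun t : ℝ => ((Circle.exp (2 * Real.pi * t) : Circle) : ℂ) := by fun_prop
    exact d.contMDiff.continuous.comp h⟩

/-- The disc `d` meets the oriented closed curve `K` in its centre only, transversally and with
intersection sign `+1`: the velocity of `K` followed by a positive basis of the tangent plane of the
disc is a positive basis of the tangent space of `L(p,1)`. -/
def IsPositiveMeridianDisc {p : ℕ} [NeZero p] (K : Curve p) (d : Disc p) : Prop :=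
  (∀ z : ℂ, ‖z‖ ≤ 1 → z ≠ 0 → ∀ t, d z ≠ K t) ∧
  ∃ t, d 0 = K t ∧ IsPositiveBasis p (K t)
    ![velocity K t, mfderiv 𝓘(ℝ, ℂ) (𝓡 3) d 0 (1 : ℂ), mfderiv 𝓘(ℝ, ℂ) (𝓡 3) d 0 Complex.I]

/-- `q` is the rational linking number of the disjoint oriented closed curves `J` and `K`:
for some `r > 0` there is a rational Seifert surface `Σ`, in the form of an integral `2`-chain with
boundary `r J`, that is transverse to `K`, and `q = (Σ • K) / r`.

Near its intersection with `K` the surface `Σ` consists of finitely many discs `d k`, each meeting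
`K` positively and transversally in its centre and taken with multiplicity `n k` (so that `n k = -1`
is a negative intersection); the remaining part `c` of `Σ` is disjoint from `K`.  So
`∂c = r J - ∑ k, n k • ∂(d k)`, and the intersection number `Σ • K` is `∑ k, n k`. -/
def IsRationalLinkingNumber {p : ℕ} [NeZero p] (J K : Curve p) (q : ℚ) : Prop :=
  ∃ (r : ℕ) (m : ℕ) (d : Fin m → Disc p) (n : Fin m → ℤ)
    (c : C(stdSimplex ℝ (Fin 3), LensSpace p) →₀ ℤ),
    0 < r ∧
    (∀ k, IsPositiveMeridianDisc K (d k)) ∧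
    (∀ σ ∈ c.support, ∀ x t, σ x ≠ K t) ∧
    chainBoundary c =
      Finsupp.single (curveSimplex (J : C(ℝ, LensSpace p))) (r : ℤ) -
        ∑ k, Finsupp.single (curveSimplex (discBoundary (d k))) (n k) ∧
    q = (∑ k, (n k : ℚ)) / r

/-- `q` is the rational Thurston–Bennequin invariant of the Legendrian knot `L` in `(L(p,1), ξ)`:
the (symmetric) rational linking number of `L` and a push-off `L'` along the contact framing. -/
def IsRationalTB {p : ℕ} [NeZero p]
    (ξ : ∀ x : LensSpace p, Submodule ℝ (TangentSpace (𝓡 3) x)) (L : Curve p) (q : ℚ) : Prop :=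
  ∃ L' : Curve p, IsContactPushOff ξ L L' ∧ IsRationalLinkingNumber L' L q

end LensHopf

end

noncomputable section

namespace LensHopf

/-! ### Winding numbers -/

/-! Write K for the component `L i`, the image under φ of the circle y_j = 0, where j is the index
other than i. The function y_j^p descends to L(p,1); carried over by φ it vanishes exactly on K
(`eq_standardHopf`, `coordPow_rev_standardHopf`). A loop J off K therefore has an integer winding
number N, and its rational linking number with K is N/p (`isRationalLinkingNumber_iff`).

No other value is possible: the increment of log y_j^p is a cochain that vanishes on boundaries of
chains off K (`logCochain_chainBoundary`) and equals p · 2πi on the boundary of a positive meridian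
disc (`HasWinding.of_meridianDisc`), so ∂c = rJ - ∑ n_k ∂d_k forces rN = p ∑ n_k. The value N/p is
attained: the complement of K is the quotient of ℂ × ℝ by a translation, so a loop there is
homologous to its winding number times one basic loop (`IsBoundaryIn.loop_sub_zsmul`), and pJ - N ∂d
bounds off K for any positive meridian disc d.

Now let J be a contact push-off of K. The function conj(y_i) y_j also descends and is a complex
coordinate normal to K. Its derivative in the push-off direction is a nowhere zero loop c in ℂ, with
winding number m say. Since |y_i|^(2p) y_j^p = (conj(y_i) y_j)^p y_i^p and y_i^p winds once along K,
it follows that N = pm + 1 (`hasWinding_pushOff`), and the linking number is m + 1/p.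

The integer m does not depend on the push-off. As K is Legendrian, α induces a nonzero real
functional on the normal plane ℂ at each point of K (`form_eq_normalForm`), and c lies in its
kernel, a real line. The loops c of two push-offs differ by a nowhere zero real factor, which does
not wind (`HasWinding.of_normalForm`). A smooth periodic section of the kernel gives a push-off
(`exists_contactPushOff`). -/

/-- A nowhere vanishing continuous function on a simply connected space has a continuous
logarithm. -/
theorem exists_continuous_log {X : Type} [TopologicalSpace X] [SimplyConnectedSpace X]
    [LocallyPathConnectedSpace X] {g : X → ℂ} (hg : Continuous g) (h0 : ∀ x, g x ≠ 0) :
    ∃ l : X → ℂ, Continuous l ∧ ∀ x, Complex.exp (l x) = g x := by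
  obtain ⟨x₀⟩ : Nonempty X := inferInstance
  obtain ⟨f, ⟨-, hf⟩, -⟩ := Complex.isCoveringMapOn_exp.existsUnique_continuousMap_lifts
    ⟨g, hg⟩ (Complex.exp_log (h0 x₀)) (fun x => h0 x)
  exact ⟨f, f.continuous, fun x => congrFun hf x⟩

/-- Two continuous logarithms of the same function on a connected space differ by a constant. -/
theorem log_sub_log_eq {X : Type} [TopologicalSpace X] [PreconnectedSpace X] {l l' : X → ℂ}
    (hl : Continuous l) (hl' : Continuous l') (h : ∀ x, Complex.exp (l x) = Complex.exp (l' x))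
    (x y : X) : l x - l' x = l y - l' y := by
  have hc : Continuous fun x => l x - l' x := hl.sub hl'
  have := Complex.isCoveringMap_exp.const_of_comp hc (fun a a' => by
    simp [Complex.exp_sub, h, Complex.exp_ne_zero]) x y
  exact this

/-- The function `γ`, restricted to `[0, 1]`, winds `n` times around the origin. -/
def HasWinding (γ : ℝ → ℂ) (n : ℤ) : Prop :=
  ∃ l : ℝ → ℂ, Continuous l ∧ (∀ t, Complex.exp (l t) = γ t) ∧
    l 1 = l 0 + n * (2 * Real.pi * Complex.I)

namespace HasWinding

theorem exists_of_eq {γ : ℝ → ℂ} (hγ : Continuous γ) (h0 : ∀ t, γ t ≠ 0) (h1 : γ 1 = γ 0) :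
    ∃ n, HasWinding γ n := by
  obtain ⟨l, hl, hle⟩ := exists_continuous_log hγ h0
  have h : Complex.exp (l 1) = Complex.exp (l 0) := by rw [hle, hle, h1]
  obtain ⟨n, hn⟩ := Complex.exp_eq_exp_iff_exists_int.1 h
  exact ⟨n, l, hl, hle, hn⟩

theorem unique {γ : ℝ → ℂ} {m n : ℤ} (hm : HasWinding γ m) (hn : HasWinding γ n) : m = n := by
  obtain ⟨l, hl, hle, h⟩ := hm
  obtain ⟨l', hl', hle', h'⟩ := hn
  have := log_sub_log_eq hl hl' (fun x => by rw [hle, hle']) 1 0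
  rw [h, h'] at this
  have h2 : ((m : ℂ) - n) * (2 * Real.pi * Complex.I) = 0 := by linear_combination this
  have h3 : (m : ℂ) = n := by
    simpa [sub_eq_zero, Real.pi_ne_zero, Complex.I_ne_zero] using h2
  exact_mod_cast h3

theorem mul {γ γ' : ℝ → ℂ} {m n : ℤ} (hm : HasWinding γ m) (hn : HasWinding γ' n) :
    HasWinding (fun t => γ t * γ' t) (m + n) := by
  obtain ⟨l, hl, hle, h⟩ := hm
  obtain ⟨l', hl', hle', h'⟩ := hn
  refine ⟨fun t => l t + l' t, hl.add hl', fun t => by rw [Complex.exp_add, hle, hle'], ?_⟩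
  dsimp only; rw [h, h']; push_cast; ring

theorem pow {γ : ℝ → ℂ} {n : ℤ} (h : HasWinding γ n) (k : ℕ) :
    HasWinding (fun t => γ t ^ k) (k * n) := by
  obtain ⟨l, hl, hle, h⟩ := h
  refine ⟨fun t => k * l t, by fun_prop, fun t => by rw [Complex.exp_nat_mul, hle], ?_⟩
  dsimp only; rw [h]; push_cast; ring

theorem exp_int (n : ℤ) (c : ℂ) (hc : c ≠ 0) :
    HasWinding (fun t => c * Complex.exp (n * (2 * Real.pi * Complex.I) * t)) n := by
  refine ⟨fun t => Complex.log c + n * (2 * Real.pi * Complex.I) * t, by fun_prop, fun t => ?_, ?_⟩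
  · rw [Complex.exp_add, Complex.exp_log hc]
  · simp

theorem ne_zero {γ : ℝ → ℂ} {n : ℤ} (h : HasWinding γ n) (t : ℝ) : γ t ≠ 0 := by
  obtain ⟨l, -, hle, -⟩ := h
  rw [← hle]; exact Complex.exp_ne_zero _

theorem of_slitPlane {γ : ℝ → ℂ} (hγ : Continuous γ) (h : ∀ t, γ t ∈ Complex.slitPlane)
    (h1 : γ 1 = γ 0) : HasWinding γ 0 := by
  refine ⟨fun t => Complex.log (γ t), hγ.clog h,
    fun t => Complex.exp_log (Complex.slitPlane_ne_zero (h t)), by simp [h1]⟩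

theorem of_div {γ γ' : ℝ → ℂ} {n : ℤ} (h : HasWinding γ n)
    (hd : HasWinding (fun t => γ' t / γ t) 0) : HasWinding γ' n := by
  have := hd.mul h
  simp only [zero_add] at this
  convert this using 2 with t
  rw [div_mul_cancel₀ _ (h.ne_zero t)]

/-- A small perturbation does not change the winding number. -/
theorem of_norm_sub_lt {γ γ' : ℝ → ℂ} {n : ℤ} (h : HasWinding γ n) (hγ : Continuous γ)
    (hγ' : Continuous γ') (h1 : γ 1 = γ 0) (h1' : γ' 1 = γ' 0)
    (hlt : ∀ t, ‖γ' t - γ t‖ < ‖γ t‖) : HasWinding γ' n := by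
  refine h.of_div (of_slitPlane (hγ'.div hγ h.ne_zero) (fun t => ?_) (by rw [h1, h1']))
  have h0 := h.ne_zero t
  have : γ' t / γ t = 1 + (γ' t - γ t) / γ t := by field_simp; ring
  rw [this]
  apply Complex.mem_slitPlane_of_norm_lt_one
  rw [norm_div, div_lt_one (norm_pos_iff.2 h0)]
  exact hlt t

/-- Multiplication by a nowhere vanishing real function does not change the winding number. -/
theorem real_mul {γ : ℝ → ℂ} {n : ℤ} (h : HasWinding γ n) {c : ℝ → ℝ} (hc : Continuous c)
    (h0 : ∀ t, c t ≠ 0) (h1 : c 1 = c 0) : HasWinding (fun t => c t * γ t) n := by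
  have key : HasWinding (fun t => (c t : ℂ)) 0 := by
    -- Dividing by `c 0` makes the function positive, by the intermediate value theorem, so that its
    -- real logarithm is a periodic choice.
    refine ⟨fun t => (Real.log (c t / c 0) : ℂ) + Complex.log (c 0), ?_, fun t => ?_, by simp [h1]⟩
    · have : Continuous fun t => Real.log (c t / c 0) :=
        (hc.div_const _).log fun t => div_ne_zero (h0 t) (h0 0)
      fun_prop
    · have hpos : 0 < c t / c 0 := by
        by_contra hneg
        have h2 : c t / c 0 ≤ 0 := not_lt.1 hneg
        have h3 : (0 : ℝ) ∈ Set.range fun t => c t / c 0 :=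
          mem_range_of_exists_le_of_exists_ge (hc.div_const _) ⟨t, h2⟩
            ⟨0, by simp [h0 0]⟩
        obtain ⟨s, hs⟩ := h3
        exact div_ne_zero (h0 s) (h0 0) hs
      rw [Complex.exp_add, ← Complex.ofReal_exp, Real.exp_log hpos,
        Complex.exp_log (by exact_mod_cast h0 0)]
      have : (c 0 : ℂ) ≠ 0 := by exact_mod_cast h0 0
      push_cast
      field_simp
  simpa using key.mul h

/-- The winding number is invariant under homotopies of loops in the punctured plane. -/
theorem homotopy {H : ℝ → ℝ → ℂ} {a b : ℝ} (hab : a ≤ b)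
    (hH : Continuous fun x : ℝ × ℝ => H x.1 x.2)
    (h0 : ∀ s ∈ Set.Icc a b, ∀ t, H s t ≠ 0) (h1 : ∀ s ∈ Set.Icc a b, H s 1 = H s 0) {n : ℤ}
    (h : HasWinding (H a) n) : HasWinding (H b) n := by
  -- Clamping the parameter to [a, b] gives a nowhere zero function on the whole plane, which is
  -- simply connected and hence carries a logarithm.
  have hcl : Continuous fun s : ℝ => ((Set.projIcc a b hab s : Set.Icc a b) : ℝ) := by fun_prop
  have hmem : ∀ s : ℝ, ((Set.projIcc a b hab s : Set.Icc a b) : ℝ) ∈ Set.Icc a b :=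
    fun s => (Set.projIcc a b hab s).2
  obtain ⟨l, hl, hle⟩ := exists_continuous_log (X := ℝ × ℝ)
    (g := fun x => H (Set.projIcc a b hab x.1 : Set.Icc a b) x.2)
    (hH.comp ((hcl.comp continuous_fst).prodMk continuous_snd)) (fun x => h0 _ (hmem _) _)
  have hloop : ∀ s, Complex.exp (l (s, 1)) = Complex.exp (l (s, 0)) := fun s => by
    rw [hle, hle]; exact h1 _ (hmem s)
  -- The increment of the logarithm along the loop with parameter s is a continuous function of s
  -- with values in 2πiℤ, hence constant.
  have hconst := log_sub_log_eq (l := fun s : ℝ => l (s, 1)) (l' := fun s : ℝ => l (s, 0))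
    (by fun_prop) (by fun_prop) hloop b a
  have ha : HasWinding (H a) n := h
  obtain ⟨m, hm⟩ := Complex.exp_eq_exp_iff_exists_int.1 (hloop a)
  have hma : HasWinding (H a) m := ⟨fun t => l (a, t), by fun_prop, fun t => by
    rw [hle]; simp, hm⟩
  rw [h.unique hma]
  refine ⟨fun t => l (b, t), by fun_prop, fun t => by rw [hle]; simp, ?_⟩
  linear_combination hconst + hm

end HasWinding

/-! ### The logarithmic cochain -/

/-- With local path connectedness below, this provides logarithms on every simplex. -/
instance {n : ℕ} : ContractibleSpace (stdSimplex ℝ (Fin (n + 1))) :=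
  (convex_stdSimplex ℝ (Fin (n + 1))).contractibleSpace
    ⟨_, single_mem_stdSimplex ℝ (0 : Fin (n + 1))⟩

instance {n : ℕ} : LocallyPathConnectedSpace (stdSimplex ℝ (Fin n)) :=
  (convex_stdSimplex ℝ (Fin n)).locallyPathConnectedSpace

open Classical in
/-- The increment of a continuous logarithm of `f` along the standard `1`-simplex. -/
def logIncrement (f : stdSimplex ℝ (Fin 2) → ℂ) : ℂ :=
  if h : ∃ l : stdSimplex ℝ (Fin 2) → ℂ, Continuous l ∧ ∀ x, Complex.exp (l x) = f x then
    h.choose (stdSimplex.vertex 1) - h.choose (stdSimplex.vertex 0) else 0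

/-- Two logarithms differ by a constant, so the choice made in `logIncrement` does not matter. -/
theorem logIncrement_eq {f l : stdSimplex ℝ (Fin 2) → ℂ} (hl : Continuous l)
    (h : ∀ x, Complex.exp (l x) = f x) :
    logIncrement f = l (stdSimplex.vertex 1) - l (stdSimplex.vertex 0) := by
  have hex : ∃ l : stdSimplex ℝ (Fin 2) → ℂ, Continuous l ∧ ∀ x, Complex.exp (l x) = f x :=
    ⟨l, hl, h⟩
  rw [logIncrement, dif_pos hex]
  have := log_sub_log_eq hex.choose_spec.1 hl (fun x => by rw [hex.choose_spec.2, h])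
    (stdSimplex.vertex 1) (stdSimplex.vertex 0)
  linear_combination this

/-- The sum of the increments of `log g` along the simplices of a `1`-chain. -/
def logCochain {X : Type} [TopologicalSpace X] (g : X → ℂ) :
    (C(stdSimplex ℝ (Fin 2), X) →₀ ℤ) →+ ℂ :=
  Finsupp.liftAddHom fun σ => (zmultiplesHom ℂ) (logIncrement (g ∘ σ))

theorem logCochain_single {X : Type} [TopologicalSpace X] (g : X → ℂ)
    (σ : C(stdSimplex ℝ (Fin 2), X)) (n : ℤ) :
    logCochain g (Finsupp.single σ n) = n * logIncrement (g ∘ σ) := by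
  simp [logCochain]

theorem logCochain_curveSimplex {X : Type} [TopologicalSpace X] {g : X → ℂ} {γ : C(ℝ, X)}
    {m : ℤ} (h : HasWinding (fun t => g (γ t)) m) (n : ℤ) :
    logCochain g (Finsupp.single (curveSimplex γ) n) = n * (m * (2 * Real.pi * Complex.I)) := by
  obtain ⟨l, hl, hle, h1⟩ := h
  rw [logCochain_single, logIncrement_eq (l := fun x => l (x.1 1))]
  · simp [h1]
  · exact hl.comp ((continuous_apply 1).comp continuous_subtype_val)
  · intro x; rw [hle]; rfl

/-- A logarithm exists on each whole 2-simplex, and its increments along the three faces, with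
signs, cancel at the vertices. -/
theorem logCochain_chainBoundary {X : Type} [TopologicalSpace X] {g : X → ℂ}
    (c : C(stdSimplex ℝ (Fin 3), X) →₀ ℤ)
    (hg : ∀ σ ∈ c.support, Continuous (g ∘ σ) ∧ ∀ x, g (σ x) ≠ 0) :
    logCochain g (chainBoundary c) = 0 := by
  rw [chainBoundary, Finsupp.sum, map_sum]
  refine Finset.sum_eq_zero fun σ hσ => ?_
  obtain ⟨l, hl, hle⟩ := exists_continuous_log (hg σ hσ).1 (hg σ hσ).2
  rw [map_sum]
  have h : ∀ i : Fin 3, logIncrement (g ∘ (σ.comp (face i))) =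
      l (stdSimplex.vertex (i.succAbove 1)) - l (stdSimplex.vertex (i.succAbove 0)) := fun i => by
    have := logIncrement_eq (f := g ∘ (σ.comp (face i))) (l := l ∘ face i)
      (hl.comp (face i).continuous) fun x => hle _
    rw [this]
    simp [face, stdSimplex.map_vertex]
  simp only [logCochain_single, h, Fin.sum_univ_three]
  have h0 : (0 : Fin 3).succAbove 0 = 1 := rfl
  have h1 : (0 : Fin 3).succAbove 1 = 2 := rfl
  have h2 : (1 : Fin 3).succAbove 0 = 0 := rfl
  have h3 : (1 : Fin 3).succAbove 1 = 2 := rfl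
  have h4 : (2 : Fin 3).succAbove 0 = 0 := rfl
  have h5 : (2 : Fin 3).succAbove 1 = 1 := rfl
  rw [h0, h1, h2, h3, h4, h5]
  push_cast
  simp only [Fin.val_zero, Fin.val_one, Fin.val_two]
  ring

/-! ### Loops in the quotient of a vector space by a translation -/

/-- `b` is the boundary of a chain whose simplices have image in `Y`. -/
def IsBoundaryIn {X : Type} [TopologicalSpace X] (Y : Set X)
    (b : C(stdSimplex ℝ (Fin 2), X) →₀ ℤ) : Prop :=
  ∃ c : C(stdSimplex ℝ (Fin 3), X) →₀ ℤ, (∀ σ ∈ c.support, ∀ x, σ x ∈ Y) ∧ chainBoundary c = b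

namespace IsBoundaryIn

variable {X : Type} [TopologicalSpace X] {Y : Set X} {b b' : C(stdSimplex ℝ (Fin 2), X) →₀ ℤ}

theorem chainBoundary_add (c c' : C(stdSimplex ℝ (Fin 3), X) →₀ ℤ) :
    chainBoundary (c + c') = chainBoundary c + chainBoundary c' := by
  rw [chainBoundary, Finsupp.sum_add_index']
  · rfl
  · simp
  · intro σ m n
    simp [mul_add, Finset.sum_add_distrib]

theorem add (h : IsBoundaryIn Y b) (h' : IsBoundaryIn Y b') : IsBoundaryIn Y (b + b') := by
  classical
  obtain ⟨c, hc, rfl⟩ := h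
  obtain ⟨c', hc', rfl⟩ := h'
  refine ⟨c + c', fun σ hσ x => ?_, chainBoundary_add c c'⟩
  rcases Finset.mem_union.1 (Finsupp.support_add hσ) with h | h
  exacts [hc σ h x, hc' σ h x]

theorem zsmul (h : IsBoundaryIn Y b) (n : ℤ) : IsBoundaryIn Y (n • b) := by
  obtain ⟨c, hc, rfl⟩ := h
  refine ⟨n • c, fun σ hσ x => hc σ (Finsupp.support_smul hσ) x, ?_⟩
  exact map_zsmul (AddMonoidHom.mk' chainBoundary chainBoundary_add) n c

theorem neg (h : IsBoundaryIn Y b) : IsBoundaryIn Y (-b) := by simpa using h.zsmul (-1)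

theorem sub (h : IsBoundaryIn Y b) (h' : IsBoundaryIn Y b') : IsBoundaryIn Y (b - b') := by
  rw [sub_eq_add_neg]; exact h.add h'.neg

/-- The boundary of a single simplex, given its faces. -/
theorem of_simplex (σ : C(stdSimplex ℝ (Fin 3), X)) (hσ : ∀ x, σ x ∈ Y) :
    IsBoundaryIn Y (Finsupp.single (σ.comp (face 0)) 1 - Finsupp.single (σ.comp (face 1)) 1 +
      Finsupp.single (σ.comp (face 2)) 1) := by
  classical
  refine ⟨Finsupp.single σ 1, fun τ hτ x => ?_, ?_⟩
  · rw [Finset.mem_singleton.1 (Finsupp.support_single_subset hτ)]; exact hσ x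
  · rw [chainBoundary, Finsupp.sum_single_index (by simp), Fin.sum_univ_three]
    simp [sub_eq_add_neg]


/-- The faces in barycentric coordinates, so that the faces of explicit simplices can be computed.
-/
theorem face_zero_coe (x : stdSimplex ℝ (Fin 2)) : (face 0 x).1 = ![0, x.1 0, x.1 1] := by
  ext k
  change FunOnFinite.linearMap ℝ ℝ _ _ k = _
  rw [FunOnFinite.linearMap_apply_apply, Finset.sum_filter, Fin.sum_univ_two]
  fin_cases k <;> simp [Fin.succAbove] <;> rfl

theorem face_one_coe (x : stdSimplex ℝ (Fin 2)) : (face 1 x).1 = ![x.1 0, 0, x.1 1] := by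
  ext k
  change FunOnFinite.linearMap ℝ ℝ _ _ k = _
  rw [FunOnFinite.linearMap_apply_apply, Finset.sum_filter, Fin.sum_univ_two]
  fin_cases k <;> simp [Fin.succAbove] <;> rfl

theorem face_two_coe (x : stdSimplex ℝ (Fin 2)) : (face 2 x).1 = ![x.1 0, x.1 1, 0] := by
  ext k
  change FunOnFinite.linearMap ℝ ℝ _ _ k = _
  rw [FunOnFinite.linearMap_apply_apply, Finset.sum_filter, Fin.sum_univ_two]
  fin_cases k <;> simp [Fin.succAbove, Fin.ext_iff] <;> rfl

variable {E : Type} [AddCommGroup E] [Module ℝ E] [TopologicalSpace E]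
    [IsTopologicalAddGroup E] [ContinuousSMul ℝ E]

/-- The affine `1`-simplex from `a` to `b`. -/
def affineSegment (a b : E) : C(stdSimplex ℝ (Fin 2), E) :=
  ⟨fun x => x.1 0 • a + x.1 1 • b, by
    have (i : Fin 2) : Continuous fun x : stdSimplex ℝ (Fin 2) => x.1 i :=
      (continuous_apply i).comp continuous_subtype_val
    exact ((this 0).smul continuous_const).add ((this 1).smul continuous_const)⟩

/-- The affine `2`-simplex with vertices `a`, `b` and `c`. -/
def affineTriangle (a b c : E) : C(stdSimplex ℝ (Fin 3), E) :=
  ⟨fun x => x.1 0 • a + x.1 1 • b + x.1 2 • c, by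
    have (i : Fin 3) : Continuous fun x : stdSimplex ℝ (Fin 3) => x.1 i :=
      (continuous_apply i).comp continuous_subtype_val
    exact (((this 0).smul continuous_const).add ((this 1).smul continuous_const)).add
      ((this 2).smul continuous_const)⟩

theorem of_triangle (h : C(E, X)) (hY : ∀ x, h x ∈ Y) (a b c : E) :
    IsBoundaryIn Y (Finsupp.single (h.comp (affineSegment b c)) 1 -
      Finsupp.single (h.comp (affineSegment a c)) 1 +
      Finsupp.single (h.comp (affineSegment a b)) 1) := by
  have := of_simplex (Y := Y) (h.comp (affineTriangle a b c)) fun x => hY _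
  convert this using 4
  all_goals
    ext x
    simp only [ContinuousMap.comp_apply, affineSegment, affineTriangle, ContinuousMap.coe_mk,
      face_zero_coe, face_one_coe, face_two_coe]
    simp

/-- A loop in the quotient of a vector space by a translation is homologous to a multiple of the
basic loop. -/
theorem loop_sub_zsmul (h : C(E, X)) (hY : ∀ x, h x ∈ Y) (e : E) (he : ∀ x, h (x + e) = h x)
    (γ : C(ℝ, E)) (N : ℤ) (hγ : γ 1 = γ 0 + N • e) :
    IsBoundaryIn Y (Finsupp.single (curveSimplex (h.comp γ)) 1 -
      N • Finsupp.single (h.comp (affineSegment 0 e)) 1) := by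
  have heN : ∀ (k : ℤ) x, h (x + k • e) = h x := by
    intro k
    induction k using Int.induction_on with
    | zero => simp
    | succ k ih => intro x; rw [add_smul, one_smul, ← add_assoc, he, ih]
    | pred k ih =>
      intro x
      rw [← ih x, sub_smul, one_smul, ← he, add_assoc, sub_add_cancel]
  have hseg : ∀ (k : ℤ) a b, h.comp (affineSegment (a + k • e) (b + k • e)) =
      h.comp (affineSegment a b) := by
    intro k a b
    ext x
    have hx : x.1 0 + x.1 1 = 1 := by simpa using x.2.2
    have : affineSegment (a + k • e) (b + k • e) x = affineSegment a b x + k • e := by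
      have h1 : x.1 0 • (k • e) + x.1 1 • (k • e) = k • e := by rw [← add_smul, hx, one_smul]
      simp only [affineSegment, ContinuousMap.coe_mk, smul_add]
      conv_rhs => rw [← h1]
      abel
    rw [ContinuousMap.comp_apply, this, heN]; rfl
  set S : E → E → (C(stdSimplex ℝ (Fin 2), X) →₀ ℤ) :=
    fun a b => Finsupp.single (h.comp (affineSegment a b)) 1 with hS
  have hS' : ∀ (k : ℤ) a b, S (a + k • e) (b + k • e) = S a b := fun k a b => by
    simp only [hS, hseg]
  have tri : ∀ a b c, IsBoundaryIn Y (S b c - S a c + S a b) := of_triangle h hY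
  -- The triangle u, u + ke, u + (k+1)e, whose first face is a translate of [u, u + e].
  have step : ∀ (u : E) (k : ℤ), IsBoundaryIn Y (S u (u + (k + 1) • e) - S u (u + k • e) -
      S u (u + e)) := by
    intro u k
    have h1 := (tri u (u + k • e) (u + (k + 1) • e)).neg
    have h2 : S (u + k • e) (u + (k + 1) • e) = S u (u + e) := by
      rw [← hS' k u (u + e)]; congr 1; rw [add_smul, one_smul]; abel
    rw [h2] at h1
    convert h1 using 1; abel
  have mult : ∀ (u : E) (k : ℤ), IsBoundaryIn Y (S u (u + k • e) - k • S u (u + e)) := by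
    intro u k
    induction k using Int.induction_on with
    | zero => simpa using tri u u u
    | succ k ih => convert ih.add (step u k) using 1; rw [add_smul (k : ℤ) 1 (S u (u + e)), one_smul]; abel
    | pred k ih =>
      have := step u (-k - 1)
      rw [sub_add_cancel] at this
      convert ih.sub this using 1
      rw [sub_smul (-(k : ℤ)) 1 (S u (u + e)), one_smul]; abel
  -- The parallelogram 0, e, u + e, u is cut along its diagonal; its sides [0, u] and [e, u + e]
  -- have the same image.
  have base : ∀ u : E, IsBoundaryIn Y (S u (u + e) - S 0 e) := by
    intro u
    have h1 := (tri 0 u (u + e)).sub (tri 0 e (u + e))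
    have h2 : S e (u + e) = S 0 u := by simpa using hS' 1 0 u
    rw [h2] at h1
    convert h1 using 1; abel
  -- The straight-line homotopy from γ to the segment is a square, cut into the triangles σ and τ
  -- along the diagonal. Its two remaining sides are constant simplices at the same point of X and
  -- cancel.
  have straight : IsBoundaryIn Y (Finsupp.single (curveSimplex (h.comp γ)) 1 - S (γ 0) (γ 1)) := by
    have hco (i : Fin 3) : Continuous fun x : stdSimplex ℝ (Fin 3) => x.1 i :=
      (continuous_apply i).comp continuous_subtype_val
    let H : C(ℝ × ℝ, E) := ⟨fun x => (1 - x.1) • γ x.2 + x.1 • ((1 - x.2) • γ 0 + x.2 • γ 1), by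
      fun_prop⟩
    let σ : C(stdSimplex ℝ (Fin 3), E) := H.comp ⟨fun x => (x.1 2, x.1 1 + x.1 2), by
      exact (hco 2).prodMk ((hco 1).add (hco 2))⟩
    let τ : C(stdSimplex ℝ (Fin 3), E) := H.comp ⟨fun x => (x.1 1 + x.1 2, x.1 2), by
      exact ((hco 1).add (hco 2)).prodMk (hco 2)⟩
    have h1 := (of_simplex (Y := Y) (h.comp σ) fun x => hY _).sub
      (of_simplex (Y := Y) (h.comp τ) fun x => hY _)
    have hx1 : ∀ x : stdSimplex ℝ (Fin 2), x.1 0 = 1 - x.1 1 := fun x => by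
      have : x.1 0 + x.1 1 = 1 := by simpa using x.2.2
      linarith
    have e0 : (h.comp σ).comp (face 0) = ContinuousMap.const _ (h (γ 1)) := by
      ext x
      simp only [σ, H, ContinuousMap.comp_apply, ContinuousMap.coe_mk, face_zero_coe, hx1]
      simp [← add_smul]
    have e1 : (h.comp σ).comp (face 1) = (h.comp τ).comp (face 1) := by
      ext x
      simp [σ, τ, ContinuousMap.comp_apply, ContinuousMap.coe_mk, face_one_coe]
    have e2 : (h.comp σ).comp (face 2) = curveSimplex (h.comp γ) := by
      ext x
      simp [σ, H, ContinuousMap.comp_apply, face_two_coe, curveSimplex]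
    have e3 : (h.comp τ).comp (face 0) = h.comp (affineSegment (γ 0) (γ 1)) := by
      ext x
      simp [τ, H, ContinuousMap.comp_apply, face_zero_coe, affineSegment, hx1]
    have e4 : (h.comp τ).comp (face 2) = ContinuousMap.const _ (h (γ 0)) := by
      ext x
      simp [τ, H, ContinuousMap.comp_apply, face_two_coe, ← add_smul]
    have e5 : h (γ 1) = h (γ 0) := by rw [hγ, heN]
    rw [e0, e1, e2, e3, e4, e5] at h1
    convert h1 using 1; simp only [hS]; abel
  have h1 := (straight.add (by simpa [← hγ] using mult (γ 0) N)).add ((base (γ 0)).zsmul N)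
  convert h1 using 1
  rw [smul_sub]; abel

end IsBoundaryIn

/-! ### The projection as a local diffeomorphism -/

/-- The charts of the lens space are charts of the sphere composed with local sections, so
smoothness can be tested upstairs. -/
theorem contMDiffAt_of_comp_proj {p : ℕ} [NeZero p] {E H M : Type} [NormedAddCommGroup E]
    [NormedSpace ℝ E] [TopologicalSpace H] {I : ModelWithCorners ℝ E H} [TopologicalSpace M]
    [ChartedSpace H M] {f : LensSpace p → M} {x : LensSpace p}
    (h : ∀ y, proj p y = x → ContMDiffAt (𝓡 3) I ∞ (fun z => f (proj p z)) y) :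
    ContMDiffAt (𝓡 3) I ∞ f x := by
  rw [contMDiffAt_iff_source]
  have hmem := mem_chart_source (EuclideanSpace ℝ (Fin 3)) x
  have hex : ∃ b, chartAt (EuclideanSpace ℝ (Fin 3)) x =
      ((isLocalHomeomorph_proj p).localInverseAt b).trans
        (chartAt (EuclideanSpace ℝ (Fin 3)) b) := ⟨_, rfl⟩
  obtain ⟨b, hb⟩ := hex
  set ψ := chartAt (EuclideanSpace ℝ (Fin 3)) b with hψ
  set σ := (isLocalHomeomorph_proj p).localInverseAt b
  rw [hb] at hmem
  have hmem' : x ∈ σ.source ∧ σ x ∈ ψ.source := by simpa using hmem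
  have h1 : ContMDiffAt (𝓡 3) (𝓡 3) ∞ ψ.symm (ψ (σ x)) :=
    (contMDiffOn_chart_symm (I := 𝓡 3) (n := ∞) (x := b)).contMDiffAt
      (ψ.open_target.mem_nhds (ψ.map_source hmem'.2))
  have h2 : ψ.symm (ψ (σ x)) = σ x := ψ.left_inv hmem'.2
  have h3 : proj p (σ x) = x := (isLocalHomeomorph_proj p).apply_localInverseAt_of_mem hmem'.1
  have h4 : ContMDiffAt (𝓡 3) I ∞ (fun z => f (proj p z)) (ψ.symm (ψ (σ x))) := by
    rw [h2]; exact h _ h3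
  have h5 := ContMDiffAt.comp (ψ (σ x)) h4 h1
  have e1 : extChartAt (𝓡 3) x x = ψ (σ x) := by simp [extChartAt, hb]
  have e2 : f ∘ (extChartAt (𝓡 3) x).symm = (fun z => f (proj p z)) ∘ ψ.symm := by
    funext z; simp [extChartAt, hb, σ]
  rw [e1, e2]
  exact h5.contMDiffWithinAt

/-- After composition with the projection, a local section is locally the action of a root of unity.
-/
theorem contMDiffAt_localInverse_proj {p : ℕ} [NeZero p] (b : S3) {x : LensSpace p}
    (hx : x ∈ ((isLocalHomeomorph_proj p).localInverseAt b).source) :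
    ContMDiffAt (𝓡 3) (𝓡 3) ∞ ((isLocalHomeomorph_proj p).localInverseAt b) x := by
  refine contMDiffAt_of_comp_proj fun y hy => ?_
  obtain ⟨u, hu⟩ := localInverse_proj p b y (hy ▸ hx)
  exact (((contMDiff_smul p u).of_le le_top).contMDiffAt).congr_of_eventuallyEq hu

theorem isLocalDiffeomorph_proj (p : ℕ) [NeZero p] :
    IsLocalDiffeomorph (𝓡 3) (𝓡 3) ∞ (proj p) := by
  intro b
  have hs := (isLocalHomeomorph_proj p).localInverseAt_symm (x := b)
  refine ⟨{ toPartialEquiv := ((isLocalHomeomorph_proj p).localInverseAt b).symm.toPartialEquiv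
            open_source := ((isLocalHomeomorph_proj p).localInverseAt b).open_target
            open_target := ((isLocalHomeomorph_proj p).localInverseAt b).open_source
            contMDiffOn_toFun := ?_
            contMDiffOn_invFun := ?_ }, ?_, ?_⟩
  · refine ContMDiffOn.congr (contMDiff_proj p).contMDiffOn fun x _ => ?_
    exact congrFun hs x
  · exact fun x hx => (contMDiffAt_localInverse_proj b hx).contMDiffWithinAt
  · exact (isLocalHomeomorph_proj p).self_mem_localInverseAt_target
  · exact fun x _ => (congrFun hs x).symm

/-! ### Tangent vectors of the sphere -/

/-- The inclusion of the tangent space of `S³` in `ℂ²`. -/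
abbrev inclDeriv (y : S3) : TangentSpace (𝓡 3) y →L[ℝ] C2 :=
  mfderiv (𝓡 3) 𝓘(ℝ, C2) (Subtype.val : S3 → C2) y

theorem injective_inclDeriv (y : S3) : Function.Injective (inclDeriv y) := by
  intro a b h
  exact injective_mvfderiv_subtypeVal_sphere (n := 3) y h

theorem exists_inclDeriv_eq (y : S3) (c : C2) (h : inner ℝ (y : C2) c = 0) :
    ∃ u, inclDeriv y u = c := by
  have := range_mvfderiv_subtypeVal (n := 3) y
  have hc : c ∈ (ℝ ∙ (y : C2))ᗮ := Submodule.mem_orthogonal_singleton_iff_inner_right.2 h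
  rw [← this] at hc
  obtain ⟨u, hu⟩ := hc
  exact ⟨u, hu⟩

theorem inner_inclDeriv (y : S3) (u : TangentSpace (𝓡 3) y) :
    inner ℝ (y : C2) (inclDeriv y u) = 0 := by
  have := range_mvfderiv_subtypeVal (n := 3) y
  have hc : inclDeriv y u ∈ (mvfderiv (𝓡 3) (Subtype.val : S3 → C2) y).range := ⟨u, rfl⟩
  rw [this] at hc
  exact Submodule.mem_orthogonal_singleton_iff_inner_right.1 hc

/-! ### Orientations -/

theorem real_inner_eq (a c : C2) : inner ℝ a c =
    (a 0).re * (c 0).re + (a 0).im * (c 0).im + (a 1).re * (c 1).re + (a 1).im * (c 1).im := by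
  have : inner ℝ a c = (inner ℂ a c : ℂ).re := rfl
  rw [this, PiLp.inner_apply, Fin.sum_univ_two]
  simp
  ring

/-- The determinant of four vectors of `ℂ²`, the last three of which form a family. -/
def detC2 (a : C2) (c : Fin 3 → C2) : ℝ :=
  Matrix.det (Matrix.of (Fin.cons (realCoords a) fun k => realCoords (c k) : Fin 4 → Fin 4 → ℝ))

theorem detC2_eq (a : C2) (c : Fin 3 → C2) : detC2 a c = Matrix.det (Matrix.of
    ![realCoords a, realCoords (c 0), realCoords (c 1), realCoords (c 2)]) := by
  rw [detC2]
  congr 2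
  funext k
  fin_cases k <;> rfl

/-- Multiplication by ρ on ℂ² has real determinant |ρ|⁴ = 1. -/
theorem detC2_smul {ρ : ℂ} (hρ : ‖ρ‖ = 1) (a : C2) (c : Fin 3 → C2) :
    detC2 (ρ • a) (fun k => ρ • c k) = detC2 a c := by
  have h1 : ρ.re ^ 2 + ρ.im ^ 2 = 1 := by
    have := Complex.sq_norm ρ
    rw [hρ, Complex.normSq_apply] at this
    linarith
  let R : Matrix (Fin 4) (Fin 4) ℝ :=
    !![ρ.re, ρ.im, 0, 0; -ρ.im, ρ.re, 0, 0; 0, 0, ρ.re, ρ.im; 0, 0, -ρ.im, ρ.re]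
  have hR : R.det = 1 := by
    have : R.det = (ρ.re ^ 2 + ρ.im ^ 2) ^ 2 := by
      simp [R, Matrix.det_succ_row_zero, Fin.sum_univ_succ, Fin.succAbove]
      ring
    rw [this, h1, one_pow]
  have hc : ∀ v : C2, realCoords (ρ • v) = Matrix.vecMul (realCoords v) R := by
    intro v
    ext k
    fin_cases k <;> simp [realCoords, R, Matrix.vecMul, dotProduct, Fin.sum_univ_succ] <;> ring
  have : Matrix.of (Fin.cons (realCoords (ρ • a)) fun k => realCoords (ρ • c k) :
      Fin 4 → Fin 4 → ℝ) =
      Matrix.of (Fin.cons (realCoords a) fun k => realCoords (c k) : Fin 4 → Fin 4 → ℝ) * R := by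
    ext k l
    rw [Matrix.mul_apply_eq_vecMul]
    refine Fin.cases ?_ (fun k => ?_) k
    · exact congrFun (hc a) l
    · exact congrFun (hc (c k)) l
  rw [detC2, this, Matrix.det_mul, hR, mul_one, detC2]

theorem detC2_comb (a : C2) (c : Fin 3 → C2) (r₁ x₁ y₁ r₂ x₂ y₂ : ℝ) :
    detC2 a ![c 0, r₁ • c 0 + x₁ • c 1 + y₁ • c 2, r₂ • c 0 + x₂ • c 1 + y₂ • c 2] =
      (x₁ * y₂ - x₂ * y₁) * detC2 a c := by
  let N : Matrix (Fin 4) (Fin 4) ℝ :=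
    !![1, 0, 0, 0; 0, 1, 0, 0; 0, r₁, x₁, y₁; 0, r₂, x₂, y₂]
  have hN : N.det = x₁ * y₂ - x₂ * y₁ := by
    simp [N, Matrix.det_succ_row_zero, Fin.sum_univ_succ, Fin.succAbove]
    ring
  rw [← hN, detC2_eq, detC2_eq, ← Matrix.det_mul]
  congr 1
  ext k l
  fin_cases k <;> fin_cases l <;>
    simp [N, realCoords, Matrix.mul_apply, Fin.sum_univ_succ, add_assoc]

theorem norm_coe_root {p : ℕ} (u : Roots p) : ‖((u : Circle) : ℂ)‖ = 1 := Circle.norm_coe _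

theorem inclDeriv_smul {p : ℕ} (u : Roots p) (y : S3) (w : TangentSpace (𝓡 3) y) :
    inclDeriv (u • y) (mfderiv (𝓡 3) (𝓡 3) (fun x : S3 => u • x) y w) =
      ((u : Circle) : ℂ) • inclDeriv y w := by
  have h1 : MDifferentiableAt (𝓡 3) (𝓡 3) (fun x : S3 => u • x) y :=
    ((contMDiff_smul p u).of_le le_top : ContMDiff (𝓡 3) (𝓡 3) 1 _).mdifferentiableAt one_ne_zero
  have h2 (z : S3) : MDifferentiableAt (𝓡 3) 𝓘(ℝ, C2) (Subtype.val : S3 → C2) z :=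
    (contMDiff_coe_sphere (m := 1)).mdifferentiableAt one_ne_zero
  let A : C2 →L[ℝ] C2 := ((u : Circle) : ℂ) • ContinuousLinearMap.id ℝ C2
  have h3 := mfderiv_comp_apply y (h2 (u • y)) h1 w
  have h4 := mfderiv_comp_apply y (A.mdifferentiableAt (x := (y : C2))) (h2 y) w
  have h5 : (Subtype.val : S3 → C2) ∘ (fun x : S3 => u • x) = A ∘ Subtype.val := rfl
  refine h3.symm.trans ?_
  rw [h5]
  refine h4.trans ?_
  rw [ContinuousLinearMap.mfderiv_eq]
  rfl

theorem bijective_mfderiv_proj (p : ℕ) [NeZero p] (y : S3) :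
    Function.Bijective (mfderiv (𝓡 3) (𝓡 3) (proj p) y) :=
  ((isLocalDiffeomorph_proj p y).mfderivToContinuousLinearEquiv (by simp)).bijective

theorem mdifferentiableAt_proj (p : ℕ) [NeZero p] (y : S3) :
    MDifferentiableAt (𝓡 3) (𝓡 3) (proj p) y :=
  (contMDiff_proj p).mdifferentiableAt (by simp)

/-- The lift in the definition of a positive basis may be chosen freely: two lifts differ by a root
of unity, which preserves the determinant by `detC2_smul`. -/
theorem isPositiveBasis_iff (p : ℕ) [NeZero p] (y : S3) (u : Fin 3 → TangentSpace (𝓡 3) y) :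
    IsPositiveBasis p (proj p y) (fun k => mfderiv (𝓡 3) (𝓡 3) (proj p) y (u k)) ↔
      0 < detC2 y fun k => inclDeriv y (u k) := by
  refine ⟨?_, fun h => ⟨y, u, rfl, fun _ => rfl, h⟩⟩
  rintro ⟨y', u', hy, hu, hdet⟩
  obtain ⟨ρ, rfl⟩ := exists_smul_eq p hy
  have h1 : MDifferentiableAt (𝓡 3) (𝓡 3) (fun x : S3 => ρ • x) y :=
    ((contMDiff_smul p ρ).of_le le_top : ContMDiff (𝓡 3) (𝓡 3) 1 _).mdifferentiableAt one_ne_zero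
  have h2 : ∀ w, mfderiv (𝓡 3) (𝓡 3) (proj p) (ρ • y)
      (mfderiv (𝓡 3) (𝓡 3) (fun x : S3 => ρ • x) y w) = mfderiv (𝓡 3) (𝓡 3) (proj p) y w := by
    intro w
    have := mfderiv_comp_apply y (mdifferentiableAt_proj p (ρ • y)) h1 w
    rw [← this]
    have h3 : proj p ∘ (fun x : S3 => ρ • x) = proj p := funext fun x => proj_smul p ρ x
    rw [h3]
  have h3 : ∀ k, u' k = mfderiv (𝓡 3) (𝓡 3) (fun x : S3 => ρ • x) y (u k) := fun k =>
    (bijective_mfderiv_proj p (ρ • y)).1 ((hu k).trans (h2 _).symm)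
  have h4 : 0 < detC2 ((ρ • y : S3) : C2) fun k => inclDeriv (ρ • y) (u' k) := hdet
  simp only [h3, inclDeriv_smul, coe_smul] at h4
  rwa [detC2_smul (norm_coe_root ρ)] at h4

/-- Both bases share their first vector, so the determinant of the base change is that of the 2 × 2
block acting on the quotient by this vector. -/
theorem IsPositiveBasis.det_pos {p : ℕ} [NeZero p] {x : LensSpace p}
    {v w : Fin 3 → TangentSpace (𝓡 3) x} (hv : IsPositiveBasis p x v) (hw : IsPositiveBasis p x w)
    {r₁ x₁ y₁ r₂ x₂ y₂ : ℝ} (h0 : w 0 = v 0) (h1 : w 1 = r₁ • v 0 + x₁ • v 1 + y₁ • v 2)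
    (h2 : w 2 = r₂ • v 0 + x₂ • v 1 + y₂ • v 2) : 0 < x₁ * y₂ - x₂ * y₁ := by
  obtain ⟨y, rfl⟩ : ∃ y, proj p y = x := Quotient.mk_surjective x
  obtain ⟨u, hu⟩ : ∃ u : Fin 3 → TangentSpace (𝓡 3) y,
      ∀ k, mfderiv (𝓡 3) (𝓡 3) (proj p) y (u k) = v k :=
    ⟨_, fun k => ((bijective_mfderiv_proj p y).2 (v k)).choose_spec⟩
  obtain rfl : v = fun k => mfderiv (𝓡 3) (𝓡 3) (proj p) y (u k) := (funext hu).symm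
  have hv' := (isPositiveBasis_iff p y u).1 hv
  have hw' := (isPositiveBasis_iff p y
    ![u 0, r₁ • u 0 + x₁ • u 1 + y₁ • u 2, r₂ • u 0 + x₂ • u 1 + y₂ • u 2]).1 (by
      convert hw using 2 with k
      fin_cases k
      · exact h0.symm
      · simpa using h1.symm
      · simpa using h2.symm)
  have : (fun k => inclDeriv y (![u 0, r₁ • u 0 + x₁ • u 1 + y₁ • u 2,
      r₂ • u 0 + x₂ • u 1 + y₂ • u 2] k)) = ![inclDeriv y (u 0),
        r₁ • inclDeriv y (u 0) + x₁ • inclDeriv y (u 1) + y₁ • inclDeriv y (u 2),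
        r₂ • inclDeriv y (u 0) + x₂ • inclDeriv y (u 1) + y₂ • inclDeriv y (u 2)] := by
    funext k
    fin_cases k <;> simp
  rw [this, detC2_comb (y : C2) fun k => inclDeriv y (u k)] at hw'
  exact (mul_pos_iff_of_pos_right hv').1 hw'

/-! ### Maps to the sphere given by nowhere zero maps to `ℂ²` -/

/-- The radial projection of a nowhere zero map to the unit sphere. -/
def toS3 {M : Type} (f : M → C2) (h0 : ∀ x, f x ≠ 0) (x : M) : S3 :=
  ⟨‖f x‖⁻¹ • f x, by
    rw [mem_sphere_zero_iff_norm, norm_smul, norm_inv, norm_norm,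
      inv_mul_cancel₀ (norm_ne_zero_iff.2 (h0 x))]⟩

theorem continuous_toS3 {M : Type} [TopologicalSpace M] {f : M → C2} (hf : Continuous f)
    (h0 : ∀ x, f x ≠ 0) : Continuous (toS3 f h0) :=
  ((hf.norm.inv₀ fun x => norm_ne_zero_iff.2 (h0 x)).smul hf).subtype_mk _

theorem toS3_eq {M : Type} {f : M → C2} {h0 : ∀ x, f x ≠ 0} {x : M} {y : S3} (h : f x = y) :
    toS3 f h0 x = y := by
  apply Subtype.ext
  simp [toS3, h]

section

variable {E : Type} [NormedAddCommGroup E] [NormedSpace ℝ E] {f : E → C2}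

theorem contMDiff_toS3 (hf : ContDiff ℝ ∞ f) (h0 : ∀ x, f x ≠ 0) :
    ContMDiff 𝓘(ℝ, E) (𝓡 3) ∞ (toS3 f h0) := by
  have h : ContDiff ℝ ∞ fun x => ‖f x‖⁻¹ • f x :=
    ((hf.norm ℝ h0).inv fun x => norm_ne_zero_iff.2 (h0 x)).smul hf
  exact h.contMDiff.codRestrict_sphere (n := 3) _

/-- Differentiating the factor ‖f‖⁻¹ contributes only a multiple of f x. This multiple is zero
because every other term is orthogonal to f x. -/
theorem inclDeriv_mfderiv_toS3 (hf : ContDiff ℝ ∞ f) (h0 : ∀ x, f x ≠ 0) {x : E}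
    (h1 : ‖f x‖ = 1) (w : E) (hw : inner ℝ (f x) (fderiv ℝ f x w) = 0) :
    inclDeriv (toS3 f h0 x) (mfderiv 𝓘(ℝ, E) (𝓡 3) (toS3 f h0) x w) = fderiv ℝ f x w := by
  have hy : ((toS3 f h0 x : S3) : C2) = f x := by simp [toS3, h1]
  have hd : DifferentiableAt ℝ f x := hf.differentiable (by simp) x
  have hn : DifferentiableAt ℝ (fun x => ‖f x‖⁻¹) x :=
    ((hf.norm ℝ h0).inv fun x => norm_ne_zero_iff.2 (h0 x)).differentiable (by simp) x
  have h2 := mfderiv_comp_apply x ((contMDiff_coe_sphere (m := 1)).mdifferentiableAt one_ne_zero)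
    ((contMDiff_toS3 hf h0).mdifferentiableAt (x := x) (by simp)) w
  have h3 : inclDeriv (toS3 f h0 x) (mfderiv 𝓘(ℝ, E) (𝓡 3) (toS3 f h0) x w) =
      fderiv ℝ f x w + fderiv ℝ (fun x => ‖f x‖⁻¹) x w • f x := by
    refine h2.symm.trans ?_
    rw [mfderiv_eq_fderiv]
    have : (Subtype.val : S3 → C2) ∘ toS3 f h0 = fun x => ‖f x‖⁻¹ • f x := rfl
    rw [this, fderiv_fun_smul hn hd]
    simp [h1]
    rfl
  have h4 := inner_inclDeriv (toS3 f h0 x) (mfderiv 𝓘(ℝ, E) (𝓡 3) (toS3 f h0) x w)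
  rw [h3, hy, inner_add_right, hw, real_inner_smul_right, real_inner_self_eq_norm_sq, h1] at h4
  rw [h3, show fderiv ℝ (fun x => ‖f x‖⁻¹) x w = 0 by linarith, zero_smul, add_zero]

end

/-- A linear left inverse of the inclusion of the tangent space of `S³` in `ℂ²`. -/
def tangentVec (y : S3) : C2 →ₗ[ℝ] TangentSpace (𝓡 3) y :=
  ((inclDeriv y).toLinearMap.exists_leftInverse_of_injective
    (LinearMap.ker_eq_bot.2 (injective_inclDeriv y))).choose

theorem tangentVec_inclDeriv (y : S3) (u : TangentSpace (𝓡 3) y) :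
    tangentVec y (inclDeriv y u) = u :=
  LinearMap.congr_fun ((inclDeriv y).toLinearMap.exists_leftInverse_of_injective
    (LinearMap.ker_eq_bot.2 (injective_inclDeriv y))).choose_spec u

theorem inclDeriv_tangentVec {y : S3} {c : C2} (h : inner ℝ (y : C2) c = 0) :
    inclDeriv y (tangentVec y c) = c := by
  obtain ⟨u, rfl⟩ := exists_inclDeriv_eq y c h
  rw [tangentVec_inclDeriv]

/-! ### Coordinates -/

/-- The vector of `ℂ²` with entry `x.1` at `i` and entry `x.2` at the other index. -/
def pair (i : Fin 2) : ℂ × ℂ →L[ℝ] C2 :=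
  LinearMap.toContinuousLinearMap
    { toFun := fun x => WithLp.toLp 2 fun k => if k = i then x.1 else x.2
      map_add' := fun x y => by ext k; simp only [PiLp.add_apply]; split_ifs <;> rfl
      map_smul' := fun c x => by ext k; simp only [PiLp.smul_apply]; split_ifs <;> rfl }

@[simp] theorem pair_apply_self (i : Fin 2) (x : ℂ × ℂ) : pair i x i = x.1 := by
  simp [pair]

@[simp] theorem pair_apply_rev (i : Fin 2) (x : ℂ × ℂ) : pair i x i.rev = x.2 := by
  have : i.rev ≠ i := by fin_cases i <;> decide
  simp [pair, this]

theorem C2_ext (i : Fin 2) {a b : C2} (h : a i = b i) (h' : a i.rev = b i.rev) : a = b := by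
  ext k
  fin_cases i <;> fin_cases k <;> first | exact h | exact h'

theorem real_inner_eq' (i : Fin 2) (a c : C2) : inner ℝ a c =
    (a i).re * (c i).re + (a i).im * (c i).im +
      ((a i.rev).re * (c i.rev).re + (a i.rev).im * (c i.rev).im) := by
  rw [real_inner_eq]
  fin_cases i
  · simp [Fin.rev]; ring
  · simp [Fin.rev]; ring

theorem norm_sq_eq (i : Fin 2) (a : C2) : ‖a‖ ^ 2 = ‖a i‖ ^ 2 + ‖a i.rev‖ ^ 2 := by
  rw [← real_inner_self_eq_norm_sq, real_inner_eq' i, Complex.sq_norm, Complex.sq_norm,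
    Complex.normSq_apply, Complex.normSq_apply]

theorem smul_pair (i : Fin 2) (ρ : ℂ) (x : ℂ × ℂ) : ρ • pair i x = pair i (ρ * x.1, ρ * x.2) :=
  C2_ext i (by simp) (by simp)

/-- The point of the `i`-th coordinate circle with coordinate `ζ`. -/
def axisPoint (i : Fin 2) (ζ : Circle) : S3 :=
  ⟨pair i (ζ, 0), by
    rw [mem_sphere_zero_iff_norm, ← sq_eq_sq₀ (norm_nonneg _) zero_le_one, norm_sq_eq i,
      pair_apply_self, pair_apply_rev, Circle.norm_coe]
    simp⟩

@[simp] theorem coe_axisPoint (i : Fin 2) (ζ : Circle) :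
    (axisPoint i ζ : C2) = pair i ((ζ : ℂ), 0) := rfl

theorem standardHopf_eq (p : ℕ) [NeZero p] (i : Fin 2) (t : ℝ) :
    standardHopf p i t = proj p (axisPoint i (Circle.exp (2 * Real.pi * t / p))) := by
  rw [standardHopf]
  congr 2
  have : i.rev ≠ i := by fin_cases i <;> decide
  apply C2_ext i
  · simp
  · simp [this]

/-- This fixes the sign convention: the direction of the circle followed by the complex orientation
of the other axis is positive for r > 0, for both values of i. -/
theorem detC2_axis (i : Fin 2) (ζ : Circle) (r : ℝ) :
    detC2 (axisPoint i ζ : C2) ![pair i (r * Complex.I * ζ, 0), pair i (0, 1),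
      pair i (0, Complex.I)] = r := by
  have h : (ζ : ℂ).re ^ 2 + (ζ : ℂ).im ^ 2 = 1 := by
    have := Complex.sq_norm (ζ : ℂ)
    rw [Circle.norm_coe, Complex.normSq_apply] at this
    linarith
  rw [detC2_eq]
  fin_cases i
  · simp [realCoords, pair, Matrix.det_succ_row_zero, Fin.sum_univ_succ, Fin.succAbove]
    linear_combination r * h
  · simp [realCoords, pair, Matrix.det_succ_row_zero, Fin.sum_univ_succ, Fin.succAbove]
    linear_combination r * h

section

/-! ### Functions on the lens space -/

theorem root_pow {p : ℕ} (u : Roots p) : ((u : Circle) : ℂ) ^ p = 1 := by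
  have h := congrArg (fun c : Circle => (c : ℂ)) (MonoidHom.mem_ker.1 u.2)
  simpa using h

theorem conj_root_mul {p : ℕ} (u : Roots p) :
    (starRingEnd ℂ) ((u : Circle) : ℂ) * ((u : Circle) : ℂ) = 1 := by
  rw [← Complex.normSq_eq_conj_mul_self, Complex.normSq_eq_norm_sq, Circle.norm_coe]
  simp

theorem continuous_coord (k : Fin 2) : Continuous fun y : S3 => (y : C2) k :=
  (EuclideanSpace.proj (𝕜 := ℂ) k).continuous.comp continuous_subtype_val

variable (p : ℕ) [NeZero p]

/-- A function on `L(p,1)` given by an invariant function on `S³`. -/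
def descend {α : Type} (f : S3 → α) (hf : ∀ (u : Roots p) y, f (u • y) = f y) :
    LensSpace p → α :=
  Quotient.lift f fun a b h => by
    obtain ⟨u, rfl⟩ := h
    exact hf u b

theorem continuous_descend {α : Type} [TopologicalSpace α] {f : S3 → α}
    {hf : ∀ (u : Roots p) y, f (u • y) = f y} (h : Continuous f) : Continuous (descend p f hf) :=
  h.quotient_lift _

/-- The function `[y] ↦ y_k ^ p`. -/
def coordPow (k : Fin 2) : LensSpace p → ℂ :=
  descend p (fun y => (y : C2) k ^ p) fun u y => by
    simp [coe_smul, mul_pow, root_pow]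

/-- The function `[y] ↦ ‖y_k‖`. -/
def coordNorm (k : Fin 2) : LensSpace p → ℝ :=
  descend p (fun y => ‖(y : C2) k‖) fun u y => by
    simp only [coe_smul, PiLp.smul_apply, smul_eq_mul, norm_mul, Circle.norm_coe, one_mul]

/-- The function `[y] ↦ \bar{y_i} y_j`, where `j` is the index other than `i`. -/
def crossCoord (i : Fin 2) : LensSpace p → ℂ :=
  descend p (fun y => (starRingEnd ℂ) ((y : C2) i) * (y : C2) i.rev) fun u y => by
    simp only [coe_smul, PiLp.smul_apply, smul_eq_mul, map_mul]
    linear_combination (starRingEnd ℂ) ((y : C2) i) * (y : C2) i.rev * conj_root_mul u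

theorem continuous_coordPow (k : Fin 2) : Continuous (coordPow p k) :=
  continuous_descend p ((continuous_coord k).pow p)

theorem continuous_coordNorm (k : Fin 2) : Continuous (coordNorm p k) :=
  continuous_descend p (continuous_coord k).norm

theorem coordPow_eq_zero {k : Fin 2} {y : S3} : coordPow p k (proj p y) = 0 ↔ (y : C2) k = 0 :=
  pow_eq_zero_iff (NeZero.ne p)

theorem coordNorm_pos {k : Fin 2} {x : LensSpace p} (h : coordPow p k x ≠ 0) :
    0 < coordNorm p k x := by
  obtain ⟨y, rfl⟩ : ∃ y, proj p y = x := Quotient.mk_surjective x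
  exact norm_pos_iff.2 fun h0 => h ((coordPow_eq_zero p).2 h0)

/-- The identity |y_i|^(2p) y_j^p = (conj(y_i) y_j)^p y_i^p is the source of both the factor p and
the summand 1/p in the theorem. -/
theorem coordPow_rev_mul (i : Fin 2) (x : LensSpace p) :
    (((coordNorm p i x ^ 2) ^ p : ℝ) : ℂ) * coordPow p i.rev x =
      crossCoord p i x ^ p * coordPow p i x := by
  obtain ⟨y, rfl⟩ : ∃ y, proj p y = x := Quotient.mk_surjective x
  change (((‖(y : C2) i‖ ^ 2) ^ p : ℝ) : ℂ) * (y : C2) i.rev ^ p =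
    ((starRingEnd ℂ) ((y : C2) i) * (y : C2) i.rev) ^ p * (y : C2) i ^ p
  rw [← Complex.normSq_eq_norm_sq, Complex.ofReal_pow, Complex.normSq_eq_conj_mul_self]
  ring

theorem contDiff_cross (i : Fin 2) :
    ContDiff ℝ ∞ fun v : C2 => (starRingEnd ℂ) (v i) * v i.rev := by
  have h (k : Fin 2) : ContDiff ℝ ∞ fun v : C2 => v k :=
    ((EuclideanSpace.proj (𝕜 := ℂ) k).restrictScalars ℝ).contDiff
  exact (Complex.conjCLE.contDiff.comp (h i)).mul (h i.rev)

theorem contMDiff_crossCoord (i : Fin 2) : ContMDiff (𝓡 3) 𝓘(ℝ, ℂ) ∞ (crossCoord p i) :=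
  fun _ => contMDiffAt_of_comp_proj fun y _ =>
    (((contDiff_cross i).contMDiff.comp contMDiff_coe_sphere) y : _)

variable {p}

/-- Where y_j = 0 the term with the derivative of conj(y_i) drops out. So the function measures the
normal component of a vector, rotated by conj(y_i), and ignores the tangential one. -/
theorem mfderiv_crossCoord {i : Fin 2} {y : S3} (hy : (y : C2) i.rev = 0)
    (u : TangentSpace (𝓡 3) y) :
    mfderiv (𝓡 3) 𝓘(ℝ, ℂ) (fun y : S3 => crossCoord p i (proj p y)) y u =
      (starRingEnd ℂ) ((y : C2) i) * inclDeriv y u i.rev := by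
  have h (k : Fin 2) : HasFDerivAt (fun v : C2 => v k)
      ((EuclideanSpace.proj (𝕜 := ℂ) k).restrictScalars ℝ) (y : C2) :=
    ((EuclideanSpace.proj (𝕜 := ℂ) k).restrictScalars ℝ).hasFDerivAt
  have h1 : HasFDerivAt (fun v : C2 => (starRingEnd ℂ) (v i) * v i.rev) _ (y : C2) :=
    (Complex.conjCLE.toContinuousLinearMap.hasFDerivAt.comp _ (h i)).mul (h i.rev)
  have h2 := mfderiv_comp_apply y (h1.differentiableAt.mdifferentiableAt)
    ((contMDiff_coe_sphere (m := 1)).mdifferentiableAt one_ne_zero) u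
  have h3 : ∀ c : C2, fderiv ℝ (fun v : C2 => (starRingEnd ℂ) (v i) * v i.rev) y c =
      (starRingEnd ℂ) ((y : C2) i) * c i.rev := fun c => by
    rw [h1.fderiv]
    simp [hy]
  refine h2.trans ?_
  rw [mfderiv_eq_fderiv]
  exact h3 _

/-- The winding numbers of the coordinate functions along a loop. -/
theorem HasWinding.coordPow_rev {i : Fin 2} {x : ℝ → LensSpace p} (hx : Continuous x)
    (h1 : x 1 = x 0) {m n : ℤ} (hm : HasWinding (fun t => crossCoord p i (x t)) m)
    (hn : HasWinding (fun t => coordPow p i (x t)) n) :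
    HasWinding (fun t => coordPow p i.rev (x t)) (p * m + n) := by
  have hpos : ∀ t, 0 < coordNorm p i (x t) := fun t => coordNorm_pos p (hn.ne_zero t)
  have hc : Continuous fun t => ((coordNorm p i (x t) ^ 2) ^ p)⁻¹ :=
    ((((continuous_coordNorm p i).comp hx).pow 2).pow p).inv₀ fun t =>
      (pow_pos (pow_pos (hpos t) 2) p).ne'
  have := ((hm.pow p).mul hn).real_mul hc
    (fun t => inv_ne_zero (pow_pos (pow_pos (hpos t) 2) p).ne') (by rw [h1])
  convert this using 2 with t
  rw [← coordPow_rev_mul, Complex.ofReal_inv, inv_mul_cancel_left₀]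
  exact_mod_cast (pow_pos (pow_pos (hpos t) 2) p).ne'

theorem coordPow_standardHopf (i : Fin 2) (t : ℝ) :
    coordPow p i (standardHopf p i t) = Complex.exp (2 * Real.pi * Complex.I * t) := by
  rw [standardHopf_eq]
  change (pair i ((Circle.exp (2 * Real.pi * t / p) : ℂ), 0)) i ^ p = _
  have : (p : ℂ) ≠ 0 := NeZero.ne _
  rw [pair_apply_self, Circle.coe_exp, ← Complex.exp_nat_mul]
  congr 1
  push_cast
  field_simp

/-- If y_j = 0 then y_i has modulus 1, and its argument, rescaled by p/(2π), is the parameter. -/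
theorem eq_standardHopf {i : Fin 2} {x : LensSpace p} (h : coordPow p i.rev x = 0) :
    ∃ t, x = standardHopf p i t := by
  obtain ⟨y, rfl⟩ : ∃ y, proj p y = x := Quotient.mk_surjective x
  have h0 := (coordPow_eq_zero p).1 h
  have h1 : ‖(y : C2) i‖ = 1 := by
    have := norm_sq_eq i (y : C2)
    rw [h0, norm_eq_of_mem_sphere] at this
    rw [← sq_eq_sq₀ (norm_nonneg _) zero_le_one, this]
    simp
  have hp : (p : ℝ) ≠ 0 := NeZero.ne _
  refine ⟨p * Complex.arg ((y : C2) i) / (2 * Real.pi), ?_⟩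
  rw [standardHopf_eq]
  congr 1
  apply Subtype.ext
  have h2 : 2 * Real.pi * (p * Complex.arg ((y : C2) i) / (2 * Real.pi)) / p =
      Complex.arg ((y : C2) i) := by
    have := Real.pi_ne_zero
    field_simp
  apply C2_ext i
  · rw [coe_axisPoint, pair_apply_self, h2, Circle.coe_exp]
    have := Complex.norm_mul_exp_arg_mul_I ((y : C2) i)
    rw [h1] at this
    simpa using this.symm
  · rw [coe_axisPoint, pair_apply_rev, h0]

theorem coordPow_rev_standardHopf (i : Fin 2) (t : ℝ) :
    coordPow p i.rev (standardHopf p i t) = 0 := by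
  rw [standardHopf_eq, coordPow_eq_zero, coe_axisPoint, pair_apply_rev]

theorem hasWinding_coordPow_standardHopf (i : Fin 2) :
    HasWinding (fun t => coordPow p i (standardHopf p i t)) 1 := by
  have := HasWinding.exp_int 1 1 one_ne_zero
  simpa [coordPow_standardHopf] using this

/-! ### Diffeomorphic images of the standard Hopf link -/

variable (φ : LensSpace p ≃ₘ^∞⟮𝓡 3, 𝓡 3⟯ LensSpace p)

/-- The image in the lens space of the orthogonal projection of a vector to the tangent space of
the sphere. -/
def pushVec (y : S3) : C2 →ₗ[ℝ] TangentSpace (𝓡 3) (φ (proj p y)) :=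
  (mfderiv (𝓡 3) (𝓡 3) (fun y => φ (proj p y)) y).toLinearMap.comp (tangentVec y)

theorem isLocalDiffeomorph_comp_proj :
    IsLocalDiffeomorph (𝓡 3) (𝓡 3) ∞ fun y => φ (proj p y) := fun y =>
  (isLocalDiffeomorph_proj p y).comp (𝓡 3) (LensSpace p) (φ.isLocalDiffeomorph (proj p y))

theorem pushVec_inclDeriv (y : S3) (u : TangentSpace (𝓡 3) y) :
    pushVec φ y (inclDeriv y u) = mfderiv (𝓡 3) (𝓡 3) (fun y => φ (proj p y)) y u := by
  rw [pushVec, LinearMap.comp_apply, tangentVec_inclDeriv]; rfl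

theorem exists_pushVec_eq (y : S3) (v : TangentSpace (𝓡 3) (φ (proj p y))) :
    ∃ c, inner ℝ (y : C2) c = 0 ∧ pushVec φ y c = v := by
  obtain ⟨u, hu⟩ := ((isLocalDiffeomorph_comp_proj φ y).mfderivToContinuousLinearEquiv
    (by simp)).bijective.2 v
  exact ⟨inclDeriv y u, inner_inclDeriv y u, (pushVec_inclDeriv φ y u).trans hu⟩

theorem pushVec_injOn {y : S3} {c : C2} (hc : inner ℝ (y : C2) c = 0) (h : pushVec φ y c = 0) :
    c = 0 := by
  obtain ⟨u, rfl⟩ := exists_inclDeriv_eq y c hc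
  rw [pushVec_inclDeriv] at h
  have : u = 0 := ((isLocalDiffeomorph_comp_proj φ y).mfderivToContinuousLinearEquiv
    (by simp)).bijective.1 (h.trans (map_zero _).symm)
  rw [this, map_zero]

/-- The explicit curves, discs and push-offs are all given by nowhere zero maps to ℂ²; this reduces
their velocities in the lens space to derivatives in ℂ². -/
theorem mfderiv_comp_toS3 {E : Type} [NormedAddCommGroup E] [NormedSpace ℝ E] {f : E → C2}
    (hf : ContDiff ℝ ∞ f) (h0 : ∀ x, f x ≠ 0) {x : E} {y : S3} (hy : f x = y) (w : E) {c : C2}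
    (hw : fderiv ℝ f x w = c) (hc : inner ℝ (y : C2) c = 0) :
    (mfderiv 𝓘(ℝ, E) (𝓡 3) (fun x => φ (proj p (toS3 f h0 x))) x w : EuclideanSpace ℝ (Fin 3)) =
      pushVec φ y c := by
  obtain rfl := toS3_eq (h0 := h0) hy
  subst hw
  rw [← hy] at hc
  have h1 : ‖f x‖ = 1 := by rw [hy]; exact norm_eq_of_mem_sphere _
  have h2 := inclDeriv_mfderiv_toS3 hf h0 h1 w hc
  rw [← h2, pushVec_inclDeriv]
  exact mfderiv_comp_apply x
    ((isLocalDiffeomorph_comp_proj φ).contMDiff.mdifferentiableAt (by simp))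
    ((contMDiff_toS3 hf h0).mdifferentiableAt (by simp)) w

theorem contMDiff_crossCoord_comp (i : Fin 2) :
    ContMDiff (𝓡 3) 𝓘(ℝ, ℂ) ∞ fun x => crossCoord p i (φ.symm x) :=
  (contMDiff_crossCoord p i).comp φ.symm.contMDiff

theorem mfderiv_crossCoord_pushVec {i : Fin 2} {y : S3} (hy : (y : C2) i.rev = 0) {c : C2}
    (hc : inner ℝ (y : C2) c = 0) :
    mfderiv (𝓡 3) 𝓘(ℝ, ℂ) (fun x => crossCoord p i (φ.symm x)) (φ (proj p y)) (pushVec φ y c) =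
      (starRingEnd ℂ) ((y : C2) i) * c i.rev := by
  obtain ⟨u, rfl⟩ := exists_inclDeriv_eq y c hc
  rw [pushVec_inclDeriv, ← mfderiv_crossCoord (p := p) hy]
  have := mfderiv_comp_apply y
    ((contMDiff_crossCoord_comp φ i).mdifferentiableAt (by simp))
    ((isLocalDiffeomorph_comp_proj φ).contMDiff.mdifferentiableAt (x := y) (by simp)) u
  refine this.symm.trans ?_
  have h : (fun x => crossCoord p i (φ.symm x)) ∘ (fun y => φ (proj p y)) =
      fun y : S3 => crossCoord p i (proj p y) := by funext y; simp
  rw [h]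

end

section

/-! ### Meridian discs -/

/-- The winding number of a planar map with positive Jacobian at an isolated zero. -/
theorem hasWinding_small_circle {g : ℂ → ℂ} (hg : Continuous g) (hd : DifferentiableAt ℝ g 0)
    (h0 : g 0 = 0)
    (hdet : 0 < ((starRingEnd ℂ) (fderiv ℝ g 0 1) * fderiv ℝ g 0 Complex.I).im) :
    ∀ᶠ ρ : ℝ in nhdsWithin 0 (Set.Ioi 0),
      HasWinding (fun t => g (ρ * Circle.exp (2 * Real.pi * t))) 1 := by
  set A := fderiv ℝ g 0 1 with hA
  set B := fderiv ℝ g 0 Complex.I with hB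
  -- The derivative is split into a complex linear part a ζ and an antilinear part b conj(ζ). The
  -- Jacobian is |a|² - |b|², so a ζ dominates.
  set a : ℂ := (A - Complex.I * B) / 2
  set b : ℂ := (A + Complex.I * B) / 2
  have hlin : ∀ ζ : ℂ, fderiv ℝ g 0 ζ = a * ζ + b * (starRingEnd ℂ) ζ := by
    intro ζ
    have h1 : ζ = ζ.re • (1 : ℂ) + ζ.im • Complex.I := by simp
    conv_lhs => rw [h1, map_add, map_smul, map_smul, ← hA, ← hB]
    have h2 : ζ = ζ.re + ζ.im * Complex.I := (Complex.re_add_im ζ).symm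
    have h3 : (starRingEnd ℂ) ζ = ζ.re - ζ.im * Complex.I := by
      apply Complex.ext <;> simp
    rw [h3]
    simp only [a, b, Complex.real_smul]
    linear_combination (-((A - Complex.I * B) / 2)) * h2 + (B * ζ.im) * Complex.I_mul_I
  have hab : ‖b‖ < ‖a‖ := by
    rw [← sq_lt_sq₀ (norm_nonneg _) (norm_nonneg _), ← sub_pos]
    have : ‖a‖ ^ 2 - ‖b‖ ^ 2 = ((starRingEnd ℂ) A * B).im := by
      rw [Complex.sq_norm, Complex.sq_norm, Complex.normSq_apply, Complex.normSq_apply]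
      simp [a, b]
      ring
    rwa [this]
  have ha : a ≠ 0 := fun h => by simp [h] at hab; exact absurd hab (not_lt.2 (norm_nonneg _))
  -- With this error bound, remainder and antilinear part together stay below |a| ρ on the circle of
  -- radius ρ.
  have ho := hd.hasFDerivAt.isLittleO.def (show 0 < (‖a‖ - ‖b‖) / 2 by linarith)
  obtain ⟨ε, hε, hball⟩ := Metric.eventually_nhds_iff.1 ho
  filter_upwards [Ioo_mem_nhdsGT hε] with ρ hρ
  have hn : ∀ t : ℝ, ‖(ρ : ℂ) * Circle.exp (2 * Real.pi * t)‖ = ρ := fun t => by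
    rw [norm_mul, Circle.norm_coe, mul_one, Complex.norm_real, Real.norm_of_nonneg hρ.1.le]
  have hbase : HasWinding (fun t : ℝ => a * (ρ * Circle.exp (2 * Real.pi * t))) 1 := by
    have hρ0 : (ρ : ℂ) ≠ 0 := by exact_mod_cast hρ.1.ne'
    have := HasWinding.exp_int 1 (a * ρ) (mul_ne_zero ha hρ0)
    convert this using 2 with t
    rw [Circle.coe_exp, ← mul_assoc]
    congr 2
    push_cast; ring
  have hc : Continuous fun t : ℝ => (ρ : ℂ) * Circle.exp (2 * Real.pi * t) := by fun_prop
  have hloop : (Circle.exp (2 * Real.pi * 1)) = Circle.exp (2 * Real.pi * 0) := by simp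
  refine hbase.of_norm_sub_lt (by fun_prop) (hg.comp hc) (by rw [hloop]) (by rw [hloop])
    fun t => ?_
  set ζ : ℂ := (ρ : ℂ) * Circle.exp (2 * Real.pi * t) with hζ
  have h1 := hball (y := ζ) (by rw [dist_zero_right, hζ, hn]; exact hρ.2)
  rw [h0, sub_zero, sub_zero, hlin, hζ, hn, ← hζ] at h1
  calc ‖g ζ - a * ζ‖ = ‖(g ζ - (a * ζ + b * (starRingEnd ℂ) ζ)) + b * (starRingEnd ℂ) ζ‖ := by
        congr 1; ring
    _ ≤ (‖a‖ - ‖b‖) / 2 * ρ + ‖b‖ * ρ := by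
        refine (norm_add_le _ _).trans (add_le_add h1 ?_)
        rw [norm_mul, RCLike.norm_conj, hζ, hn]
    _ < ‖a * ζ‖ := by
        rw [norm_mul, hζ, hn]
        nlinarith [hρ.1]

variable {p : ℕ} [NeZero p] {φ : LensSpace p ≃ₘ^∞⟮𝓡 3, 𝓡 3⟯ LensSpace p}

/-- The point of the standard link component over a parameter, in the sphere. -/
abbrev hopfPoint (p : ℕ) (i : Fin 2) (t : ℝ) : S3 := axisPoint i (Circle.exp (2 * Real.pi * t / p))

theorem inner_axisPoint (i : Fin 2) (ζ : Circle) (r : ℝ) (b : ℂ) :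
    inner ℝ (axisPoint i ζ : C2) (pair i (r * Complex.I * ζ, b)) = 0 := by
  rw [real_inner_eq' i]
  simp
  ring

theorem exists_eq_of_inner_axisPoint {i : Fin 2} {ζ : Circle} {c : C2}
    (h : inner ℝ (axisPoint i ζ : C2) c = 0) : ∃ r : ℝ, c = pair i (r * Complex.I * ζ, c i.rev) := by
  have h1 : (ζ : ℂ) * (starRingEnd ℂ) ζ = 1 := by
    rw [Complex.mul_conj, Complex.normSq_eq_norm_sq, Circle.norm_coe]; simp
  rw [real_inner_eq' i] at h
  simp only [coe_axisPoint, pair_apply_self, pair_apply_rev, Complex.zero_re, Complex.zero_im,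
    zero_mul, add_zero] at h
  refine ⟨((starRingEnd ℂ) (ζ : ℂ) * c i).im, C2_ext i ?_ (by simp)⟩
  have h2 : (starRingEnd ℂ) (ζ : ℂ) * c i =
      ((starRingEnd ℂ) (ζ : ℂ) * c i).im * Complex.I := by
    apply Complex.ext
    · simp; linarith
    · simp
  rw [pair_apply_self, ← h2]
  linear_combination (-c i) * h1

theorem contDiff_hopfCurve (p : ℕ) (i : Fin 2) : ContDiff ℝ ∞ fun t : ℝ =>
    pair i (Complex.exp ((2 * Real.pi / p * t : ℝ) * Complex.I), 0) := by
  refine (pair i).contDiff.comp (ContDiff.prodMk ?_ contDiff_const)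
  exact ((Complex.ofRealCLM.contDiff.comp (contDiff_const.mul contDiff_id)).mul
    contDiff_const).cexp

theorem hopfPoint_eq (p : ℕ) (i : Fin 2) (t : ℝ) : (hopfPoint p i t : C2) =
    pair i (Complex.exp ((2 * Real.pi / p * t : ℝ) * Complex.I), 0) := by
  rw [coe_axisPoint, Circle.coe_exp]
  congr 5
  ring

theorem velocity_eq {i : Fin 2} {K : Curve p} (hK : ∀ t, K t = φ (standardHopf p i t)) (t : ℝ) :
    (velocity K t : EuclideanSpace ℝ (Fin 3)) = pushVec φ (hopfPoint p i t)
      (pair i ((2 * Real.pi / p : ℝ) * Complex.I * Circle.exp (2 * Real.pi * t / p), 0)) := by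
  have h0 : ∀ t : ℝ, pair i (Complex.exp ((2 * Real.pi / p * t : ℝ) * Complex.I), 0) ≠ 0 := by
    intro t
    rw [← hopfPoint_eq]
    exact ne_zero_of_mem_unit_sphere _
  have hK' : (K : ℝ → LensSpace p) = fun t => φ (proj p (toS3 _ h0 t)) := by
    funext t
    rw [hK, standardHopf_eq]
    exact congrArg (fun y => φ (proj p y)) (toS3_eq (h0 := h0) (hopfPoint_eq p i t).symm).symm
  rw [velocity, hK']
  refine mfderiv_comp_toS3 φ (contDiff_hopfCurve p i) h0 (hopfPoint_eq p i t).symm (1 : ℝ) ?_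
    (inner_axisPoint i _ _ _)
  have h1 : HasDerivAt (fun t : ℝ => Complex.exp ((2 * Real.pi / p * t : ℝ) * Complex.I))
      ((2 * Real.pi / p : ℝ) * Complex.I * Circle.exp (2 * Real.pi * t / p)) t := by
    have h2 : HasDerivAt (fun t : ℝ => ((2 * Real.pi / p * t : ℝ) : ℂ) * Complex.I)
        ((2 * Real.pi / p : ℝ) * Complex.I) t := by
      simpa using (((hasDerivAt_id t).const_mul (2 * Real.pi / p : ℝ)).ofReal_comp).mul_const
        Complex.I
    convert h2.cexp using 1
    rw [Circle.coe_exp, mul_comm]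
    congr 4
    ring
  have h2 : HasFDerivAt (fun t : ℝ => pair i (Complex.exp ((2 * Real.pi / p * t : ℝ) * Complex.I), 0))
      _ t := (pair i).hasFDerivAt.comp t (h1.hasFDerivAt.prodMk (hasFDerivAt_const (0 : ℂ) t))
  rw [h2.fderiv]
  simp

theorem pushVec_eq (y : S3) (c : C2) : pushVec φ y c =
    mfderiv (𝓡 3) (𝓡 3) φ (proj p y) (mfderiv (𝓡 3) (𝓡 3) (proj p) y (tangentVec y c)) :=
  mfderiv_comp_apply y (φ.contMDiff.mdifferentiableAt (by simp)) (mdifferentiableAt_proj p y) _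

theorem IsPositiveBasis.congr {x x' : LensSpace p} (hx : x = x')
    {v v' : Fin 3 → EuclideanSpace ℝ (Fin 3)} (hv : v = v') (h : IsPositiveBasis p x v) :
    IsPositiveBasis p x' v' := by
  subst hx hv
  exact h

theorem inner_axisPoint_zero (i : Fin 2) (ζ : Circle) (b : ℂ) :
    inner ℝ (axisPoint i ζ : C2) (pair i (0, b)) = 0 := by
  simpa using inner_axisPoint i ζ 0 b

/-- The standard basis of the tangent space at a point of a link component is positive. -/
theorem isPositiveBasis_standard (hφ : PreservesOrientation p φ) {i : Fin 2} {K : Curve p}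
    (hK : ∀ t, K t = φ (standardHopf p i t)) (t : ℝ) :
    IsPositiveBasis p (K t) ![velocity K t, pushVec φ (hopfPoint p i t) (pair i (0, 1)),
      pushVec φ (hopfPoint p i t) (pair i (0, Complex.I))] := by
  have hp : (0 : ℝ) < p := Nat.cast_pos.2 (NeZero.pos p)
  set y := hopfPoint p i t with hy
  set c : Fin 3 → C2 := ![pair i ((2 * Real.pi / p : ℝ) * Complex.I *
    Circle.exp (2 * Real.pi * t / p), 0), pair i (0, 1), pair i (0, Complex.I)] with hc
  have h1 : 0 < detC2 y fun k => inclDeriv y (tangentVec y (c k)) := by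
    have : (fun k => inclDeriv y (tangentVec y (c k))) = c := by
      funext k
      apply inclDeriv_tangentVec
      fin_cases k
      · exact inner_axisPoint i _ _ _
      · exact inner_axisPoint_zero i _ _
      · exact inner_axisPoint_zero i _ _
    rw [this, hc, hy, hopfPoint, detC2_axis]
    have := Real.pi_pos
    positivity
  refine IsPositiveBasis.congr ?_ ?_ (hφ _ _ ((isPositiveBasis_iff p y _).2 h1))
  · rw [hK, standardHopf_eq]
  · funext k
    refine (pushVec_eq y (c k)).symm.trans ?_
    fin_cases k
    · exact (velocity_eq hK t).symm
    · rfl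
    · rfl

/-- By positivity of the intersection, conj(y_i) y_j restricted to the disc has positive Jacobian at
the centre and winds once on a small circle. There y_i^p is close to a nonzero constant, so y_j^p
winds p times. The concentric circles out to the boundary avoid K, so the winding number persists.
-/
theorem HasWinding.of_meridianDisc (hφ : PreservesOrientation p φ) {i : Fin 2} {K : Curve p}
    (hK : ∀ t, K t = φ (standardHopf p i t)) {d : Disc p} (hd : IsPositiveMeridianDisc K d) :
    HasWinding (fun t => coordPow p i.rev (φ.symm (discBoundary d t))) p := by
  obtain ⟨hdisj, t₀, ht₀, hpos⟩ := hd
  have hp : (0 : ℝ) < p := Nat.cast_pos.2 (NeZero.pos p)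
  have hpi := Real.pi_pos
  have hKt : d 0 = φ (proj p (hopfPoint p i t₀)) := by rw [ht₀, hK, standardHopf_eq]
  have hvel := velocity_eq hK t₀
  have hstd := isPositiveBasis_standard hφ hK t₀
  set y := hopfPoint p i t₀ with hy
  set ζ := Circle.exp (2 * Real.pi * t₀ / p) with hζ
  -- the derivative of the disc in terms of the standard basis
  obtain ⟨V₀, hV₀⟩ : ∃ V : EuclideanSpace ℝ (Fin 3), V = velocity K t₀ := ⟨_, rfl⟩
  obtain ⟨V₁, hV₁⟩ : ∃ V : EuclideanSpace ℝ (Fin 3), V = pushVec φ y (pair i (0, 1)) := ⟨_, rfl⟩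
  obtain ⟨V₂, hV₂⟩ : ∃ V : EuclideanSpace ℝ (Fin 3), V = pushVec φ y (pair i (0, Complex.I)) :=
    ⟨_, rfl⟩
  -- Every vector is expanded in the standard positive basis; the normal component b holds the last
  -- two coefficients.
  have hdec : ∀ v : EuclideanSpace ℝ (Fin 3), ∃ (r : ℝ) (b : ℂ) (c : C2),
      inner ℝ (y : C2) c = 0 ∧ c i.rev = b ∧ v = pushVec φ y c ∧
      v = r • V₀ + b.re • V₁ + b.im • V₂ := by
    intro v
    obtain ⟨c, hc, hv⟩ := exists_pushVec_eq φ y v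
    obtain ⟨r, hr⟩ := exists_eq_of_inner_axisPoint hc
    refine ⟨r / (2 * Real.pi / p), c i.rev, c, hc, rfl, hv.symm, ?_⟩
    have hsum : c = (r / (2 * Real.pi / p)) • pair i ((2 * Real.pi / p : ℝ) * Complex.I * ζ, 0) +
        (c i.rev).re • pair i (0, 1) + (c i.rev).im • pair i (0, Complex.I) := by
      conv_lhs => rw [hr, ← hζ]
      rw [← map_smul, ← map_smul, ← map_smul, ← map_add, ← map_add]
      congr 1
      have hp' : (p : ℂ) ≠ 0 := NeZero.ne _
      have hpi' : (Real.pi : ℂ) ≠ 0 := by exact_mod_cast hpi.ne'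
      ext1
      · simp
        field_simp
      · simp
    rw [hV₀, hV₁, hV₂, hvel]
    refine hv.symm.trans ?_
    conv_lhs => rw [hsum]
    rw [map_add, map_add, map_smul, map_smul, map_smul]
    rfl
  set g : ℂ → ℂ := fun z => crossCoord p i (φ.symm (d z)) with hg
  have hgs : ContMDiff 𝓘(ℝ, ℂ) 𝓘(ℝ, ℂ) ∞ g := (contMDiff_crossCoord_comp φ i).comp d.contMDiff
  have hyrev : (y : C2) i.rev = 0 := by rw [hy, coe_axisPoint, pair_apply_rev]
  have hyi : (y : C2) i = ζ := by rw [hy, coe_axisPoint, pair_apply_self]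
  -- The base point is a variable here because the tangent space depends on it; the equality is then
  -- substituted rather than rewritten.
  have hkey : ∀ (x : LensSpace p) (v : EuclideanSpace ℝ (Fin 3)) (c : C2),
      x = φ (proj p y) → v = pushVec φ y c → inner ℝ (y : C2) c = 0 →
      (mfderiv (𝓡 3) 𝓘(ℝ, ℂ) (fun x => crossCoord p i (φ.symm x)) x v : ℂ) =
        (starRingEnd ℂ) (ζ : ℂ) * c i.rev := by
    rintro x v c rfl rfl hc
    rw [← hyi]
    exact mfderiv_crossCoord_pushVec φ hyrev hc
  have hder : ∀ w : ℂ, fderiv ℝ g 0 w =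
      (mfderiv (𝓡 3) 𝓘(ℝ, ℂ) (fun x => crossCoord p i (φ.symm x)) (d 0)
        (mfderiv 𝓘(ℝ, ℂ) (𝓡 3) d 0 w) : ℂ) := by
    intro w
    rw [← mfderiv_eq_fderiv]
    exact mfderiv_comp_apply (0 : ℂ) ((contMDiff_crossCoord_comp φ i).mdifferentiableAt (by simp))
      (d.contMDiff.mdifferentiableAt (by simp)) w
  subst hV₀ hV₁ hV₂
  obtain ⟨r₁, b₁, c₁, hc₁, hb₁, hv₁, he₁⟩ := hdec (mfderiv 𝓘(ℝ, ℂ) (𝓡 3) d 0 (1 : ℂ))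
  obtain ⟨r₂, b₂, c₂, hc₂, hb₂, hv₂, he₂⟩ := hdec (mfderiv 𝓘(ℝ, ℂ) (𝓡 3) d 0 Complex.I)
  have hdet := hstd.det_pos hpos (r₁ := r₁) (x₁ := b₁.re) (y₁ := b₁.im) (r₂ := r₂) (x₂ := b₂.re)
    (y₂ := b₂.im) rfl he₁ he₂
  have hnorm : (ζ : ℂ) * (starRingEnd ℂ) ζ = 1 := by
    rw [Complex.mul_conj, Complex.normSq_eq_norm_sq, Circle.norm_coe]; simp
  have hdet' : 0 < ((starRingEnd ℂ) (fderiv ℝ g 0 1) * fderiv ℝ g 0 Complex.I).im := by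
    rw [hder, hder, hkey _ _ c₁ hKt hv₁ hc₁, hkey _ _ c₂ hKt hv₂ hc₂, hb₁, hb₂]
    -- The common rotation by conj(ζ) does not affect the Jacobian.
    have : (starRingEnd ℂ) ((starRingEnd ℂ) (ζ : ℂ) * b₁) * ((starRingEnd ℂ) (ζ : ℂ) * b₂) =
        (starRingEnd ℂ) b₁ * b₂ := by
      rw [map_mul, Complex.conj_conj]
      linear_combination (starRingEnd ℂ) b₁ * b₂ * hnorm
    rw [this, Complex.mul_im, Complex.conj_re, Complex.conj_im]
    linarith
  have hg0 : g 0 = 0 := by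
    change crossCoord p i (φ.symm (d 0)) = 0
    rw [hKt, φ.symm_apply_apply]
    change (starRingEnd ℂ) ((y : C2) i) * (y : C2) i.rev = 0
    rw [hyrev, mul_zero]
  have hsmall := hasWinding_small_circle hgs.continuous
    (hgs.contDiff.differentiable (by simp) 0) hg0 hdet'
  -- the other coordinate does not vanish near the centre
  have hcz (k : Fin 2) : Continuous fun z : ℂ => coordPow p k (φ.symm (d z)) :=
    (continuous_coordPow p k).comp (φ.symm.continuous.comp d.contMDiff.continuous)
  set z₀ := coordPow p i (φ.symm (d 0)) with hz₀
  have hz₀' : z₀ ≠ 0 := by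
    rw [hz₀, hKt, φ.symm_apply_apply, Ne, coordPow_eq_zero, hyi]
    exact ζ.coe_ne_zero
  have hnear : ∀ᶠ ζ in nhds (0 : ℂ), ‖coordPow p i (φ.symm (d ζ)) - z₀‖ < ‖z₀‖ := by
    have : Continuous fun z : ℂ => ‖coordPow p i (φ.symm (d z)) - z₀‖ :=
      ((hcz i).sub continuous_const).norm
    refine this.continuousAt.eventually_lt continuousAt_const ?_
    simpa [← hz₀] using hz₀'
  obtain ⟨ε, hε, hball⟩ := Metric.eventually_nhds_iff.1 hnear
  obtain ⟨ρ, hρw, hρε, hρ1⟩ := (hsmall.and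
    (Filter.Eventually.and (Ioo_mem_nhdsGT hε) (Ioo_mem_nhdsGT (zero_lt_one' ℝ)))).exists
  have hn : ∀ s : ℝ, 0 ≤ s → ∀ t : ℝ, ‖(s : ℂ) * Circle.exp (2 * Real.pi * t)‖ = s :=
    fun s hs t => by
      rw [norm_mul, Circle.norm_coe, mul_one, Complex.norm_real, Real.norm_of_nonneg hs]
  have hloop : (Circle.exp (2 * Real.pi * 1)) = Circle.exp (2 * Real.pi * 0) := by simp
  have hconst : HasWinding (fun _ => z₀) 0 := by
    simpa using HasWinding.exp_int 0 z₀ hz₀'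
  have hcirc : Continuous fun t : ℝ => (ρ : ℂ) * Circle.exp (2 * Real.pi * t) := by fun_prop
  have hzw : HasWinding (fun t => coordPow p i
      (φ.symm (d (ρ * Circle.exp (2 * Real.pi * t))))) 0 := by
    refine hconst.of_norm_sub_lt continuous_const ((hcz i).comp hcirc) rfl (by rw [hloop])
      fun t => hball ?_
    rw [dist_zero_right, hn ρ hρε.1.le]
    exact hρε.2
  have hρwind := HasWinding.coordPow_rev (p := p) (i := i)
    (x := fun t => φ.symm (d (ρ * Circle.exp (2 * Real.pi * t))))
    (φ.symm.continuous.comp (d.contMDiff.continuous.comp hcirc)) (by simp only [hloop]) hρw hzw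
  have hfin := HasWinding.homotopy (n := p * 1 + 0) (a := ρ) (b := 1)
    (H := fun s t => coordPow p i.rev (φ.symm (d (s * Circle.exp (2 * Real.pi * t))))) hρ1.2.le
    ((hcz i.rev).comp (by fun_prop)) (fun s hs t h0 => ?_) (fun s _ => by simp only [hloop]) hρwind
  · simpa [LensHopf.discBoundary] using hfin
  · obtain ⟨t', ht'⟩ := eq_standardHopf h0
    have hs0 : 0 < s := hρε.1.trans_le hs.1
    refine hdisj (s * Circle.exp (2 * Real.pi * t)) ?_ ?_ t' ?_
    · rw [hn s hs0.le]; exact hs.2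
    · exact mul_ne_zero (by exact_mod_cast hs0.ne') (Circle.coe_ne_zero _)
    · rw [hK, ← ht', φ.apply_symm_apply]

end

section

/-! ### The rational linking number with a component of a Hopf link -/

variable {p : ℕ} [NeZero p] {φ : LensSpace p ≃ₘ^∞⟮𝓡 3, 𝓡 3⟯ LensSpace p}

theorem coe_toS3 {M : Type} {f : M → C2} {h0 : ∀ x, f x ≠ 0} (x : M) :
    (toS3 f h0 x : C2) = ((‖f x‖⁻¹ : ℝ) : ℂ) • f x := by
  rw [toS3, Complex.coe_smul]

/-- Both vectors are unit vectors, so s = 1 and they differ by a root of unity. The factor s absorbs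
the normalisations in `toS3`. -/
theorem proj_eq_proj {y y' : S3} {s : ℝ} {ρ : ℂ} (hs : 0 < s) (hρ : ρ ^ p = 1)
    (h : (y : C2) = ((s : ℂ) * ρ) • (y' : C2)) : proj p y = proj p y' := by
  have hρ1 : ‖ρ‖ = 1 := Complex.norm_eq_one_of_pow_eq_one hρ (NeZero.ne p)
  have hs1 : s = 1 := by
    have := congrArg norm h
    rw [norm_smul, norm_eq_of_mem_sphere, norm_eq_of_mem_sphere, norm_mul, hρ1, Complex.norm_real,
      Real.norm_of_nonneg hs.le] at this
    linarith
  let u : Circle := ⟨ρ, mem_sphere_zero_iff_norm.2 hρ1⟩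
  have hu : u ∈ Roots p := by
    rw [MonoidHom.mem_ker]
    apply Circle.ext
    change ((u ^ p : Circle) : ℂ) = 1
    rw [Circle.coe_pow]
    exact hρ
  have : y = (⟨u, hu⟩ : Roots p) • y' := by
    apply Subtype.ext
    rw [h, coe_smul, hs1]
    simp [u]
  rw [this, proj_smul]

/-- The disc is the affine slice z ↦ (1, z), projected to the sphere; its tangent plane at the
centre is the normal plane with its complex orientation. -/
theorem exists_meridianDisc (hφ : PreservesOrientation p φ) {i : Fin 2} {K : Curve p}
    (hK : ∀ t, K t = φ (standardHopf p i t)) : ∃ d : Disc p, IsPositiveMeridianDisc K d := by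
  let f : ℂ → C2 := fun z => pair i (1, z)
  have h0 : ∀ z, f z ≠ 0 := fun z h => by
    have := congrArg (fun v : C2 => v i) h
    simp [f] at this
  have hf : ContDiff ℝ ∞ f := (pair i).contDiff.comp (contDiff_const.prodMk contDiff_id)
  let d : Disc p := ⟨fun z => φ (proj p (toS3 f h0 z)),
    (isLocalDiffeomorph_comp_proj φ).contMDiff.comp (contMDiff_toS3 hf h0)⟩
  have hy : f 0 = hopfPoint p i 0 := by simp [f]
  have hder : ∀ w : ℂ, (mfderiv 𝓘(ℝ, ℂ) (𝓡 3) d 0 w : EuclideanSpace ℝ (Fin 3)) =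
      pushVec φ (hopfPoint p i 0) (pair i (0, w)) := fun w => by
    refine mfderiv_comp_toS3 φ hf h0 hy w ?_ (inner_axisPoint_zero i _ _)
    have : HasFDerivAt f ((pair i).comp ((0 : ℂ →L[ℝ] ℂ).prod (ContinuousLinearMap.id ℝ ℂ))) 0 :=
      (pair i).hasFDerivAt.comp (0 : ℂ) ((hasFDerivAt_const (1 : ℂ) (0 : ℂ)).prodMk
        (hasFDerivAt_id (0 : ℂ)))
    rw [this.fderiv]
    simp
  have hd0 : d 0 = K 0 := by
    rw [hK, standardHopf_eq]
    exact congrArg (fun y => φ (proj p y)) (toS3_eq (h0 := h0) hy)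
  refine ⟨d, fun z _ hz t h => hz ?_, 0, hd0, ?_⟩
  · have h1 : proj p (toS3 f h0 z) = standardHopf p i t := φ.injective (h.trans (hK t))
    have h2 := coordPow_rev_standardHopf (p := p) i t
    rw [← h1, coordPow_eq_zero, coe_toS3] at h2
    simpa [f, h0] using h2
  · refine IsPositiveBasis.congr rfl ?_ (isPositiveBasis_standard hφ hK 0)
    funext k
    fin_cases k
    · rfl
    · exact (hder 1).symm
    · exact (hder Complex.I).symm

/-- The universal covering of the complement of a link component. -/
def complementVec (p : ℕ) (i : Fin 2) (x : ℂ × ℝ) : C2 :=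
  pair i (x.1 * Complex.exp ((2 * Real.pi * x.2 / p : ℝ) * Complex.I),
    Complex.exp ((2 * Real.pi * x.2 / p : ℝ) * Complex.I))

theorem complementVec_ne_zero (p : ℕ) (i : Fin 2) (x : ℂ × ℝ) : complementVec p i x ≠ 0 :=
  fun h => by
    have := congrArg (fun v : C2 => v i.rev) h
    simp [complementVec] at this

theorem continuous_complementVec (p : ℕ) (i : Fin 2) : Continuous (complementVec p i) :=
  (pair i).continuous.comp (by fun_prop)

variable (φ) in
/-- The universal covering of the complement of a link component. -/
def complementCover (i : Fin 2) : C(ℂ × ℝ, LensSpace p) :=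
  ⟨fun x => φ (proj p (toS3 (complementVec p i) (complementVec_ne_zero p i) x)),
    φ.continuous.comp ((contMDiff_proj p).continuous.comp
      (continuous_toS3 (continuous_complementVec p i) _))⟩

theorem complementCover_eq {i : Fin 2} {x : ℂ × ℝ} {y : S3} {s : ℝ} {ρ : ℂ} (hs : 0 < s)
    (hρ : ρ ^ p = 1) (h : (y : C2) = ((s : ℂ) * ρ) • complementVec p i x) :
    complementCover φ i x = φ (proj p y) := by
  have h0 := norm_pos_iff.2 (complementVec_ne_zero p i x)
  change φ (proj p _) = _
  rw [proj_eq_proj (y := y) (mul_pos hs h0) hρ]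
  rw [h, coe_toS3, smul_smul]
  congr 1
  have : (‖complementVec p i x‖ : ℂ) ≠ 0 := by exact_mod_cast h0.ne'
  push_cast
  field_simp

/-- Translation by 1 in the real direction multiplies both coordinates by e^(2πi/p), an element of
the acting group. -/
theorem complementCover_add (i : Fin 2) (x : ℂ × ℝ) :
    complementCover φ i (x + (0, 1)) = complementCover φ i x := by
  have hp : (p : ℂ) ≠ 0 := NeZero.ne _
  have h0 := norm_pos_iff.2 (complementVec_ne_zero p i (x + (0, 1)))
  refine (complementCover_eq (i := i) (x := x) (y := toS3 (complementVec p i)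
    (complementVec_ne_zero p i) (x + (0, 1)))
    (ρ := Complex.exp (2 * Real.pi * Complex.I / p)) (inv_pos.2 h0) ?_ ?_).symm
  · rw [← Complex.exp_nat_mul, mul_div_cancel₀ _ hp, Complex.exp_two_pi_mul_I]
  · rw [coe_toS3, mul_smul]
    congr 1
    have : Complex.exp ((2 * Real.pi * (x.2 + 1) / p : ℝ) * Complex.I) =
        Complex.exp (2 * Real.pi * Complex.I / p) *
          Complex.exp ((2 * Real.pi * x.2 / p : ℝ) * Complex.I) := by
      rw [← Complex.exp_add]
      congr 1
      push_cast
      ring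
    rw [complementVec, complementVec, smul_pair, Prod.fst_add, Prod.snd_add, this]
    congr 2
    simp
    ring

theorem complementCover_ne {i : Fin 2} {K : Curve p} (hK : ∀ t, K t = φ (standardHopf p i t))
    (x : ℂ × ℝ) (t : ℝ) : complementCover φ i x ≠ K t := by
  intro h
  have h1 : proj p (toS3 (complementVec p i) (complementVec_ne_zero p i) x) =
      standardHopf p i t := φ.injective (h.trans (hK t))
  have h2 := coordPow_rev_standardHopf (p := p) i t
  rw [← h1, coordPow_eq_zero, coe_toS3, PiLp.smul_apply, smul_eq_zero] at h2
  rcases h2 with h2 | h2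
  · simp [complementVec_ne_zero] at h2
  · simp [complementVec] at h2

/-- The coordinates of the lift are y_i / y_j, which is well defined on L(p,1), and the imaginary
part of log y_j^p divided by 2π, which grows by N along the loop. -/
theorem exists_lift_complementCover {i : Fin 2} {γ : ℝ → LensSpace p} (hγ : Continuous γ)
    (h1 : γ 1 = γ 0) {N : ℤ} (hN : HasWinding (fun t => coordPow p i.rev (φ.symm (γ t))) N) :
    ∃ γ' : C(ℝ, ℂ × ℝ), (∀ t, complementCover φ i (γ' t) = γ t) ∧
      γ' 1 = γ' 0 + N • ((0, 1) : ℂ × ℝ) := by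
  have h0 := hN.ne_zero
  obtain ⟨l, hl, hle, hl1⟩ := hN
  have hγ' : Continuous fun t => φ.symm (γ t) := φ.symm.continuous.comp hγ
  have hpos : ∀ t, 0 < coordNorm p i.rev (φ.symm (γ t)) := fun t => coordNorm_pos p (h0 t)
  have hp : (p : ℂ) ≠ 0 := NeZero.ne _
  have hpi : (Real.pi : ℂ) ≠ 0 := by exact_mod_cast Real.pi_ne_zero
  have hpi' := Real.pi_ne_zero
  -- The first entry is y_i conj(y_j) / |y_j|² = y_i / y_j.
  refine ⟨⟨fun t => ((starRingEnd ℂ) (crossCoord p i (φ.symm (γ t))) /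
    ((coordNorm p i.rev (φ.symm (γ t)) ^ 2 : ℝ) : ℂ), (l t).im / (2 * Real.pi)), ?_⟩, fun t => ?_, ?_⟩
  · refine Continuous.prodMk ?_ (by fun_prop)
    refine (Complex.continuous_conj.comp
      ((contMDiff_crossCoord p i).continuous.comp hγ')).div ?_ fun t => ?_
    · exact Complex.continuous_ofReal.comp (((continuous_coordNorm p i.rev).comp hγ').pow 2)
    · exact_mod_cast (pow_pos (hpos t) 2).ne'
  · obtain ⟨y, hy⟩ : ∃ y, proj p y = φ.symm (γ t) := Quotient.mk_surjective _
    have hγt : γ t = φ (proj p y) := by rw [hy, φ.apply_symm_apply]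
    have hn : 0 < ‖(y : C2) i.rev‖ := by have := hpos t; rw [← hy] at this; exact this
    have hyj : (y : C2) i.rev ≠ 0 := norm_pos_iff.1 hn
    have hn0 : (‖(y : C2) i.rev‖ : ℂ) ≠ 0 := by exact_mod_cast hn.ne'
    have hexp : Complex.exp (l t) = (y : C2) i.rev ^ p := by
      rw [hle]; dsimp only; rw [← hy]; rfl
    have ha : (starRingEnd ℂ) (crossCoord p i (φ.symm (γ t))) /
        ((coordNorm p i.rev (φ.symm (γ t)) ^ 2 : ℝ) : ℂ) = (y : C2) i / (y : C2) i.rev := by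
      rw [← hy]
      change (starRingEnd ℂ) ((starRingEnd ℂ) ((y : C2) i) * (y : C2) i.rev) /
        ((‖(y : C2) i.rev‖ ^ 2 : ℝ) : ℂ) = _
      rw [← Complex.normSq_eq_norm_sq, Complex.normSq_eq_conj_mul_self, map_mul,
        Complex.conj_conj]
      have : (starRingEnd ℂ) ((y : C2) i.rev) ≠ 0 := by simpa using hyj
      field_simp
    set e : ℂ := Complex.exp ((2 * Real.pi * ((l t).im / (2 * Real.pi)) / p : ℝ) * Complex.I)
      with he
    have he0 : e ≠ 0 := Complex.exp_ne_zero _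
    have hep : (‖(y : C2) i.rev‖ : ℂ) ^ p * e ^ p = (y : C2) i.rev ^ p := by
      have h2 : (‖(y : C2) i.rev‖ : ℂ) ^ p = Complex.exp ((l t).re : ℂ) := by
        rw [← Complex.ofReal_exp, ← Complex.norm_exp, hexp, norm_pow]
        push_cast; rfl
      rw [h2, he, ← Complex.exp_nat_mul, ← Complex.exp_add, ← hexp]
      congr 1
      conv_rhs => rw [← Complex.re_add_im (l t)]
      push_cast
      field_simp
    rw [hγt]
    -- The logarithm of y_j^p determines the phase of y_j only up to a p-th root of unity, which is
    -- this ρ.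
    refine complementCover_eq hn (ρ := (y : C2) i.rev / (‖(y : C2) i.rev‖ * e)) ?_ ?_
    · rw [div_pow, mul_pow, hep, div_self (pow_ne_zero p hyj)]
    · rw [complementVec, ContinuousMap.coe_mk, ha, smul_pair]
      apply C2_ext i
      · rw [pair_apply_self]
        change _ = _ * ((y : C2) i / (y : C2) i.rev * e)
        field_simp
      · rw [pair_apply_rev]
        change _ = _ * e
        field_simp
  · have : (l 1).im = (l 0).im + N * (2 * Real.pi) := by rw [hl1]; simp
    simp only [ContinuousMap.coe_mk, h1, this]
    ext1
    · simp
    · simp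
      field_simp

/-- The rational linking number of a loop with a component of a Hopf link is determined by the
winding number of the other coordinate. -/
theorem isRationalLinkingNumber_iff (hφ : PreservesOrientation p φ) {i : Fin 2} {J K : Curve p}
    (hK : ∀ t, K t = φ (standardHopf p i t)) (hJ : J 1 = J 0) {N : ℤ}
    (hN : HasWinding (fun t => coordPow p i.rev (φ.symm (J t))) N) (q : ℚ) :
    IsRationalLinkingNumber J K q ↔ q = N / p := by
  have hp : (p : ℚ) ≠ 0 := NeZero.ne _
  constructor
  · rintro ⟨r, m, d, n, c, hr, hd, hc, hbd, rfl⟩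
    set g : LensSpace p → ℂ := fun x => coordPow p i.rev (φ.symm x) with hg
    have hgc : Continuous g := (continuous_coordPow p i.rev).comp φ.symm.continuous
    have h1 := logCochain_chainBoundary (g := g) c fun σ hσ =>
      ⟨hgc.comp σ.continuous, fun x h0 => by
        obtain ⟨t, ht⟩ := eq_standardHopf h0
        exact hc σ hσ x t (by rw [hK, ← ht, φ.apply_symm_apply])⟩
    rw [hbd, map_sub, map_sum, logCochain_curveSimplex (γ := (J : C(ℝ, LensSpace p))) hN] at h1
    have h2 : ∀ k, logCochain g (Finsupp.single (curveSimplex (discBoundary (d k))) (n k)) =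
        n k * (p * (2 * Real.pi * Complex.I)) := fun k => by
      have := logCochain_curveSimplex (g := g) (HasWinding.of_meridianDisc hφ hK (hd k)) (n k)
      rw [this]; push_cast; rfl
    simp only [h2] at h1
    rw [← Finset.sum_mul] at h1
    have h3 : ((r * N : ℂ) - (∑ k, (n k : ℂ)) * p) * (2 * Real.pi * Complex.I) = 0 := by
      push_cast at h1
      linear_combination h1
    have h4 : ((r : ℂ) * N - (∑ k, (n k : ℂ)) * p) = 0 := by
      simpa [Real.pi_ne_zero, Complex.I_ne_zero] using h3
    have h5 : (r : ℚ) * N = (∑ k, (n k : ℚ)) * p := by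
      have := sub_eq_zero.1 h4
      exact_mod_cast this
    have hr' : (r : ℚ) ≠ 0 := by exact_mod_cast hr.ne'
    rw [div_eq_div_iff hr' hp]
    linarith
  · rintro rfl
    obtain ⟨d, hd⟩ := exists_meridianDisc hφ hK
    have hloop : ∀ {γ : C(ℝ, LensSpace p)} {M : ℤ}, γ 1 = γ 0 →
        HasWinding (fun t => coordPow p i.rev (φ.symm (γ t))) M →
        IsBoundaryIn {x | ∀ t, x ≠ K t} (Finsupp.single (curveSimplex γ) 1 -
          M • Finsupp.single ((complementCover φ i).comp
            (IsBoundaryIn.affineSegment 0 ((0, 1) : ℂ × ℝ))) 1) := by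
      intro γ M h1 hM
      obtain ⟨γ', hγ', hγ1⟩ := exists_lift_complementCover γ.continuous h1 hM
      have : γ = (complementCover φ i).comp γ' := by ext t; exact (hγ' t).symm
      rw [this]
      exact IsBoundaryIn.loop_sub_zsmul (Y := {x | ∀ t, x ≠ K t}) _ (fun x t => complementCover_ne hK x t) _
        (complementCover_add i) γ' M hγ1
    -- J is homologous to N basic loops and ∂d to p of them; the multiples p and N make the basic
    -- loops cancel.
    have hb1 := (hloop (γ := (J : C(ℝ, LensSpace p))) hJ hN).zsmul p
    have hb2 := (hloop (γ := discBoundary d) (by simp [discBoundary])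
      (HasWinding.of_meridianDisc hφ hK hd)).zsmul N
    obtain ⟨c, hc, hbd⟩ := hb1.sub hb2
    refine ⟨p, 1, fun _ => d, fun _ => N, c, NeZero.pos p, fun _ => hd, hc, ?_, by simp⟩
    rw [hbd, Fin.sum_univ_one]
    have hs : ∀ (σ : C(stdSimplex ℝ (Fin 2), LensSpace p)) (k : ℤ),
        Finsupp.single σ k = k • Finsupp.single σ 1 := fun σ k => by simp
    rw [hs _ (p : ℤ), hs _ N, smul_sub, smul_sub, smul_smul, smul_smul, mul_comm N]
    abel

end

section

/-! ### Framings and push-offs -/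

/-- By compactness of one period the estimate is uniform in t. -/
theorem eventually_near_of_periodic {D : ℝ × ℝ → ℂ} (hD : Continuous D)
    (hper : ∀ s t, D (s, t + 1) = D (s, t)) (h0 : ∀ t, D (0, t) ≠ 0) :
    ∀ᶠ s in nhds (0 : ℝ), ∀ t, 2 * ‖D (s, t) - D (0, t)‖ < ‖D (0, t)‖ := by
  have hK : IsCompact (Set.Icc (0 : ℝ) 1) := isCompact_Icc
  have h1 := hK.eventually_forall_of_forall_eventually (x₀ := (0 : ℝ))
    (P := fun s t => 2 * ‖D (s, t) - D (0, t)‖ < ‖D (0, t)‖) fun t _ => by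
      have hc : Continuous fun z : ℝ × ℝ => 2 * ‖D (z.1, z.2) - D (0, z.2)‖ := by fun_prop
      have hc' : Continuous fun z : ℝ × ℝ => ‖D (0, z.2)‖ := by fun_prop
      refine hc.continuousAt.eventually_lt hc'.continuousAt ?_
      simpa using h0 t
  filter_upwards [h1] with s hs t
  have hp : Function.Periodic (fun t => (D (s, t), D (0, t))) 1 := fun t => by
    simp only [hper]
  obtain ⟨t', ht', he⟩ := hp.exists_mem_Ico₀ zero_lt_one t
  have he1 : D (s, t) = D (s, t') := congrArg Prod.fst he
  have he2 : D (0, t) = D (0, t') := congrArg Prod.snd he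
  rw [he1, he2]
  exact hs t' ⟨ht'.1, ht'.2.le⟩

/-- The mean value inequality applied to u ↦ H(u, t) - u c, whose derivative is at most ‖c‖/2 for
small u, uniformly in t. -/
theorem eventually_near_linear {H : ℝ × ℝ → ℂ} (hH : ContDiff ℝ 1 H)
    (hper : ∀ s t, H (s, t + 1) = H (s, t)) (h0 : ∀ t, H (0, t) = 0)
    (hd : ∀ t, fderiv ℝ H (0, t) (1, 0) ≠ 0) :
    ∀ᶠ s in nhdsWithin (0 : ℝ) (Set.Ioi 0), ∀ t,
      ‖H (s, t) - s * fderiv ℝ H (0, t) (1, 0)‖ < ‖s * fderiv ℝ H (0, t) (1, 0)‖ := by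
  have hdc : Continuous fun x => fderiv ℝ H x (1, 0) :=
    (hH.continuous_fderiv one_ne_zero).clm_apply continuous_const
  have hdper : ∀ s t, fderiv ℝ H (s, t + 1) (1, 0) = fderiv ℝ H (s, t) (1, 0) := fun s t => by
    have h1 : (fun x : ℝ × ℝ => H (x + (0, 1))) = H := by
      funext ⟨a, b⟩; simpa using hper a b
    have h2 := fderiv_comp_add_right (𝕜 := ℝ) (f := H) (x := (s, t)) ((0, 1) : ℝ × ℝ)
    rw [h1] at h2
    rw [h2]
    simp
  obtain ⟨ε, hε, hball⟩ := Metric.eventually_nhds_iff.1 (eventually_near_of_periodic hdc hdper hd)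
  filter_upwards [Ioo_mem_nhdsGT hε] with s hs t
  set c := fderiv ℝ H (0, t) (1, 0) with hc
  have hder : ∀ u : ℝ, HasDerivAt (fun u : ℝ => H (u, t) - u * c)
      (fderiv ℝ H (u, t) (1, 0) - c) u := fun u => by
    have h1 : HasDerivAt (fun u : ℝ => (u, t)) ((1, 0) : ℝ × ℝ) u :=
      (hasDerivAt_id u).prodMk (hasDerivAt_const u t)
    have h2 := ((hH.differentiable one_ne_zero (u, t)).hasFDerivAt).comp_hasDerivAt u h1
    have h3 := ((hasDerivAt_id u).ofReal_comp).mul_const c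
    exact (h2.sub h3).congr_deriv (by simp)
  have h1 := (convex_Icc (0 : ℝ) s).norm_image_sub_le_of_norm_hasDerivWithin_le
    (fun u _ => (hder u).hasDerivWithinAt) (C := ‖c‖ / 2) (fun u hu => by
      have := hball (y := u) (by
        rw [Real.dist_0_eq_abs, abs_of_nonneg hu.1]; exact hu.2.trans_lt hs.2) t
      linarith) (Set.left_mem_Icc.2 hs.1.le) (Set.right_mem_Icc.2 hs.1.le)
  rw [h0] at h1
  simp only [Complex.ofReal_zero, zero_mul, sub_zero, Real.norm_of_nonneg hs.1.le] at h1
  refine h1.trans_lt ?_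
  rw [norm_mul, Complex.norm_real, Real.norm_of_nonneg hs.1.le]
  have := norm_pos_iff.2 (hd t)
  nlinarith [hs.1]

variable {p : ℕ} [NeZero p] {φ : LensSpace p ≃ₘ^∞⟮𝓡 3, 𝓡 3⟯ LensSpace p}

/-- A tangent vector of the lens space as an element of the model space. -/
def toModel {x : LensSpace p} (v : TangentSpace (𝓡 3) x) : EuclideanSpace ℝ (Fin 3) := v

/-- The derivative of the cross coordinate along a vector at a point of a link component. -/
abbrev crossDeriv (φ : LensSpace p ≃ₘ^∞⟮𝓡 3, 𝓡 3⟯ LensSpace p) (i : Fin 2) (x : LensSpace p)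
    (v : EuclideanSpace ℝ (Fin 3)) : ℂ :=
  mfderiv (𝓡 3) 𝓘(ℝ, ℂ) (fun x => crossCoord p i (φ.symm x)) x v

theorem exists_eq_velocity_add {i : Fin 2} {K : Curve p}
    (hK : ∀ t, K t = φ (standardHopf p i t)) (t : ℝ) (v : EuclideanSpace ℝ (Fin 3)) :
    ∃ (r : ℝ) (b : ℂ), v = r • toModel (velocity K t) +
        toModel (pushVec φ (hopfPoint p i t) (pair i (0, b))) ∧
      crossDeriv φ i (K t) v =
        (starRingEnd ℂ) (Circle.exp (2 * Real.pi * t / p) : ℂ) * b := by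
  have hp : (p : ℂ) ≠ 0 := NeZero.ne _
  have hpi : (Real.pi : ℂ) ≠ 0 := by exact_mod_cast Real.pi_ne_zero
  have hKt : K t = φ (proj p (hopfPoint p i t)) := by rw [hK, standardHopf_eq]
  obtain ⟨c, hc, hv⟩ := exists_pushVec_eq φ (hopfPoint p i t) v
  obtain ⟨r, hr⟩ := exists_eq_of_inner_axisPoint hc
  refine ⟨r / (2 * Real.pi / p), c i.rev, ?_, ?_⟩
  · have hsum : c = (r / (2 * Real.pi / p)) • pair i ((2 * Real.pi / p : ℝ) * Complex.I *
        Circle.exp (2 * Real.pi * t / p), 0) + pair i (0, c i.rev) := by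
      conv_lhs => rw [hr]
      rw [← map_smul, ← map_add]
      congr 1
      ext1
      · simp only [Prod.fst_add, Prod.smul_fst, Complex.real_smul]
        push_cast
        field_simp
        simp
      · simp
    rw [velocity_eq hK]
    refine hv.symm.trans ?_
    conv_lhs => rw [hsum]
    rw [map_add, map_smul]
    rfl
  · have hkey : ∀ x, x = φ (proj p (hopfPoint p i t)) →
        crossDeriv φ i x v = (starRingEnd ℂ) (Circle.exp (2 * Real.pi * t / p) : ℂ) * c i.rev := by
      rintro x rfl
      have := mfderiv_crossCoord_pushVec φ (i := i) (y := hopfPoint p i t) (by simp) hc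
      rw [hv] at this
      rw [coe_axisPoint, pair_apply_self] at this
      exact this
    exact hkey _ hKt

/-- If the normal component of v vanished, v would be a multiple of the velocity. -/
theorem crossDeriv_ne_zero {i : Fin 2} {K : Curve p} (hK : ∀ t, K t = φ (standardHopf p i t))
    (t : ℝ) (v : EuclideanSpace ℝ (Fin 3))
    (h : LinearIndependent ℝ (M := EuclideanSpace ℝ (Fin 3)) ![velocity K t, v]) :
    crossDeriv φ i (K t) v ≠ 0 := by
  obtain ⟨r, b, hv, hb⟩ := exists_eq_velocity_add hK t v
  intro h0
  rw [hb] at h0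
  have hb0 : b = 0 := by
    rcases mul_eq_zero.1 h0 with h1 | h1
    · simp at h1
    · exact h1
  have h' := LinearIndependent.pair_iff (M := EuclideanSpace ℝ (Fin 3)).1 h
  have h2 : toModel (pushVec φ (hopfPoint p i t) (pair i (0, b))) = 0 := by
    have : pair i ((0 : ℂ), (0 : ℂ)) = 0 := map_zero (pair i)
    rw [hb0, this, map_zero]
    rfl
  have := (h' r (-1) (by
    conv_lhs => rw [hv, h2]
    simp [toModel])).2
  norm_num at this

/-- The linking of a push-off with the curve is determined by the framing. -/
theorem hasWinding_pushOff {i : Fin 2} {K : Curve p} (hK : ∀ t, K t = φ (standardHopf p i t))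
    {F : C^∞⟮𝓘(ℝ, ℝ × ℝ), ℝ × ℝ; 𝓡 3, LensSpace p⟯} (hper : ∀ s t, F (s, t + 1) = F (s, t))
    (hF0 : ∀ t, F (0, t) = K t)
    (hli : ∀ t, LinearIndependent ℝ (M := EuclideanSpace ℝ (Fin 3))
      ![velocity K t, mfderiv 𝓘(ℝ, ℝ × ℝ) (𝓡 3) F (0, t) ((1, 0) : ℝ × ℝ)])
    (hdisj : ∀ s t t', 0 < s → s ≤ 1 → F (s, t) ≠ K t') :
    ∃ c : ℝ → ℂ, Continuous c ∧ c 1 = c 0 ∧ (∀ t, c t ≠ 0) ∧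
      (∀ t, c t = crossDeriv φ i (K t) (mfderiv 𝓘(ℝ, ℝ × ℝ) (𝓡 3) F (0, t) ((1, 0) : ℝ × ℝ))) ∧
      ∀ m, HasWinding c m →
        HasWinding (fun t => coordPow p i.rev (φ.symm (F (1, t)))) (p * m + 1) := by
  set H : ℝ × ℝ → ℂ := fun x => crossCoord p i (φ.symm (F x)) with hHdef
  have hH : ContDiff ℝ ∞ H := ((contMDiff_crossCoord_comp φ i).comp F.contMDiff).contDiff
  have hder : ∀ t, fderiv ℝ H (0, t) (1, 0) =
      crossDeriv φ i (K t) (mfderiv 𝓘(ℝ, ℝ × ℝ) (𝓡 3) F (0, t) ((1, 0) : ℝ × ℝ)) := fun t => by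
    rw [← mfderiv_eq_fderiv, ← hF0]
    exact mfderiv_comp_apply ((0, t) : ℝ × ℝ)
      ((contMDiff_crossCoord_comp φ i).mdifferentiableAt (by simp))
      (F.contMDiff.mdifferentiableAt (by simp)) ((1, 0) : ℝ × ℝ)
  have hne : ∀ t, fderiv ℝ H (0, t) (1, 0) ≠ 0 := fun t => by
    rw [hder]
    exact crossDeriv_ne_zero hK t _ (hli t)
  have hHper : ∀ s t, H (s, t + 1) = H (s, t) := fun s t => by simp only [hHdef, hper]
  have hH0 : ∀ t, H (0, t) = 0 := fun t => by
    simp only [hHdef, hF0, hK, φ.symm_apply_apply, standardHopf_eq]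
    change (starRingEnd ℂ) (pair i _ i) * pair i _ i.rev = 0
    rw [pair_apply_rev, mul_zero]
  have hcc : Continuous fun t : ℝ => fderiv ℝ H (0, t) (1, 0) :=
    ((hH.continuous_fderiv (by simp)).comp (by fun_prop)).clm_apply continuous_const
  have hc1 : fderiv ℝ H (0, 1) (1, 0) = fderiv ℝ H (0, 0) (1, 0) := by
    have h1 : (fun x : ℝ × ℝ => H (x + (0, 1))) = H := by
      funext ⟨a, b⟩; simpa using hHper a b
    have h2 := fderiv_comp_add_right (𝕜 := ℝ) (f := H) (x := (0, 0)) ((0, 1) : ℝ × ℝ)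
    rw [h1] at h2
    rw [h2]
    simp
  refine ⟨fun t => fderiv ℝ H (0, t) (1, 0), hcc, hc1, hne, hder, fun m hm => ?_⟩
  have hFc (k : Fin 2) : Continuous fun x : ℝ × ℝ => coordPow p k (φ.symm (F x)) :=
    (continuous_coordPow p k).comp (φ.symm.continuous.comp F.contMDiff.continuous)
  have hZ0 : ∀ t, coordPow p i (φ.symm (F (0, t))) = coordPow p i (standardHopf p i t) :=
    fun t => by rw [hF0, hK, φ.symm_apply_apply]
  have hstd := hasWinding_coordPow_standardHopf (p := p) i
  have hnear := eventually_near_of_periodic (hFc i) (fun s t => by simp only [hper]) fun t => by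
    rw [hZ0]; exact hstd.ne_zero t
  have hlin := eventually_near_linear (hH.of_le (by simp)) hHper hH0 hne
  -- For this small s, conj(y_i) y_j along F(s, ·) is close to s c(t), and y_i^p is close to its
  -- values on K; so they wind m times and once.
  obtain ⟨s, ⟨hs1, hs2⟩, hs⟩ := ((hlin.and (hnear.filter_mono nhdsWithin_le_nhds)).and
    (Ioo_mem_nhdsGT (zero_lt_one' ℝ))).exists
  have hF1 : ∀ s, F (s, 1) = F (s, 0) := fun s => by simpa using hper s 0
  have hs0 : (s : ℂ) ≠ 0 := by exact_mod_cast hs.1.ne'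
  have hsc : HasWinding (fun t => s * fderiv ℝ H (0, t) (1, 0)) m := by
    simpa using hm.real_mul (c := fun _ => s) continuous_const (fun _ => hs.1.ne') rfl
  have hcross : HasWinding (fun t => crossCoord p i (φ.symm (F (s, t)))) m :=
    hsc.of_norm_sub_lt (continuous_const.mul hcc) (hH.continuous.comp (by fun_prop))
      (by rw [hc1]) (by simp only [hF1]) hs1
  have hz : HasWinding (fun t => coordPow p i (φ.symm (F (s, t)))) 1 := by
    have h1 : HasWinding (fun t => coordPow p i (φ.symm (F (0, t)))) 1 := by
      simpa only [hZ0] using hstd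
    refine h1.of_norm_sub_lt ((hFc i).comp (by fun_prop)) ((hFc i).comp (by fun_prop))
      (by simp only [hF1]) (by simp only [hF1]) fun t => ?_
    have := hs2 t
    have := norm_nonneg (coordPow p i (φ.symm (F (s, t))) - coordPow p i (φ.symm (F (0, t))))
    linarith
  have hw := HasWinding.coordPow_rev (p := p) (i := i) (x := fun t => φ.symm (F (s, t)))
    (φ.symm.continuous.comp (F.contMDiff.continuous.comp (by fun_prop)))
    (by simp only [hF1]) hcross hz
  -- The curves between parameters s and 1 avoid K, so y_j^p does not vanish on them.
  refine HasWinding.homotopy (a := s) (b := 1)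
    (H := fun s t => coordPow p i.rev (φ.symm (F (s, t)))) hs.2.le (hFc i.rev)
    (fun s' hs' t h0 => ?_) (fun s' _ => by simp only [hF1]) hw
  obtain ⟨t', ht'⟩ := eq_standardHopf h0
  exact hdisj s' t t' (hs.1.trans_le hs'.1) hs'.2 (by rw [hK, ← ht', φ.apply_symm_apply])

/-- The kernel of a nonzero real-linear functional on `ℂ` is a line. -/
theorem exists_real_mul_of_ker {β : ℂ →ₗ[ℝ] ℝ} (hβ : β ≠ 0) {b b' : ℂ} (hb : β b = 0)
    (hb' : β b' = 0) (h0 : b ≠ 0) : ∃ r : ℝ, b' = r * b := by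
  have hdec : ∀ z : ℂ, β z = (z / b).im * β (Complex.I * b) := fun z => by
    have h1 : z = (z / b).re • b + (z / b).im • (Complex.I * b) := by
      rw [Complex.real_smul, Complex.real_smul, ← mul_assoc, ← add_mul, Complex.re_add_im,
        div_mul_cancel₀ _ h0]
    conv_lhs => rw [h1, map_add, map_smul, map_smul, hb, smul_zero, zero_add, smul_eq_mul]
  have hI : β (Complex.I * b) ≠ 0 := fun h => hβ (LinearMap.ext fun z => by
    rw [hdec, h, mul_zero, LinearMap.zero_apply])
  have him : (b' / b).im = 0 := by
    have := hdec b'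
    rw [hb'] at this
    exact (mul_eq_zero.1 this.symm).resolve_right hI
  refine ⟨(b' / b).re, ?_⟩
  have h1 : b' / b = (b' / b).re := Complex.ext rfl (by simpa using him)
  rw [← h1, div_mul_cancel₀ _ h0]

end

/-! ### Push-offs along a normal field, and the form on the normal plane -/

section

/-- The version in a chart: η is the local expression of the form and g that of the map. -/
theorem contDiffAt_pairing {E : Type} [NormedAddCommGroup E] [NormedSpace ℝ E]
    {η : E → E →L[ℝ] ℝ} {g : ℝ × ℝ → E} {t : ℝ} (hg : ContDiffAt ℝ ∞ g (0, t))
    (hη : ContDiffAt ℝ ∞ η (g (0, t))) :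
    ContDiffAt ℝ ∞ (fun t : ℝ => η (g (0, t)) (fderiv ℝ g (0, t) (1, 0))) t := by
  have hline : ContDiffAt ℝ ∞ (fun t : ℝ => ((0, t) : ℝ × ℝ)) t :=
    (contDiff_const.prodMk contDiff_id).contDiffAt
  have h2 : ContDiffAt ℝ ∞ (fun t : ℝ => g (0, t)) t := ContDiffAt.comp t hg hline
  have h3 : ContDiffAt ℝ ∞ (fun t : ℝ => η (g (0, t))) t :=
    ContDiffAt.comp (f := fun t : ℝ => g (0, t)) t hη h2
  have h4 : ContDiffAt ℝ ∞ (fun t : ℝ => fderiv ℝ g (0, t)) t :=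
    ContDiffAt.comp t (hg.fderiv_right (m := ∞) (by simp)) hline
  exact h3.clm_apply (h4.clm_apply contDiffAt_const)

variable {p : ℕ}

/-- The parameter on the coordinate circle, as a complex number. -/
abbrev hopfExp (p : ℕ) (t : ℝ) : ℂ := Complex.exp ((2 * Real.pi / p * t : ℝ) * Complex.I)

theorem hopfExp_eq (p : ℕ) (t : ℝ) : hopfExp p t = Circle.exp (2 * Real.pi * t / p) := by
  rw [hopfExp, Circle.coe_exp]
  congr 3
  ring

theorem conj_hopfExp_mul (p : ℕ) (t : ℝ) (b : ℂ) :
    hopfExp p t * ((starRingEnd ℂ) (hopfExp p t) * b) = b := by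
  have : hopfExp p t * (starRingEnd ℂ) (hopfExp p t) = 1 := by
    rw [hopfExp_eq, Complex.mul_conj, Complex.normSq_eq_norm_sq, Circle.norm_coe]; simp
  rw [← mul_assoc, this, one_mul]

/-- One turn in the lens space is 1/p of a turn in the sphere, so periodicity holds only up to a
root of unity. -/
theorem hopfExp_add_one (p : ℕ) (t : ℝ) :
    hopfExp p (t + 1) = Complex.exp (2 * Real.pi * Complex.I / p) * hopfExp p t := by
  rw [hopfExp, hopfExp, ← Complex.exp_add]
  congr 1
  push_cast
  ring

/-- The push-off of a coordinate circle along the normal vector field `b`. -/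
def pushOffVec (p : ℕ) (i : Fin 2) (b : ℝ → ℂ) (x : ℝ × ℝ) : C2 :=
  pair i (hopfExp p x.2, x.1 * (hopfExp p x.2 * b x.2))

theorem pushOffVec_ne_zero (p : ℕ) (i : Fin 2) (b : ℝ → ℂ) (x : ℝ × ℝ) :
    pushOffVec p i b x ≠ 0 := fun h => by
  have := congrArg (fun v : C2 => v i) h
  simp [pushOffVec] at this

theorem contDiff_pushOffVec {i : Fin 2} {b : ℝ → ℂ} (hb : ContDiff ℝ ∞ b) :
    ContDiff ℝ ∞ (pushOffVec p i b) := by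
  have h1 : ContDiff ℝ ∞ fun x : ℝ × ℝ => hopfExp p x.2 :=
    ((Complex.ofRealCLM.contDiff.comp (contDiff_const.mul contDiff_snd)).mul contDiff_const).cexp
  exact (pair i).contDiff.comp (h1.prodMk ((Complex.ofRealCLM.contDiff.comp contDiff_fst).mul
    (h1.mul (hb.comp contDiff_snd))))

theorem pushOffVec_zero (i : Fin 2) (b : ℝ → ℂ) (t : ℝ) :
    pushOffVec p i b (0, t) = hopfPoint p i t := by
  rw [hopfPoint_eq]
  change pair i (hopfExp p t, ((0 : ℝ) : ℂ) * _) = pair i (hopfExp p t, 0)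
  rw [Complex.ofReal_zero, zero_mul]

theorem fderiv_pushOffVec {i : Fin 2} {b : ℝ → ℂ} (hb : ContDiff ℝ ∞ b) (t : ℝ) :
    fderiv ℝ (pushOffVec p i b) (0, t) (1, 0) = pair i (0, hopfExp p t * b t) := by
  have h1 : HasDerivAt (fun u : ℝ => (u, t)) ((1, 0) : ℝ × ℝ) 0 :=
    (hasDerivAt_id (0 : ℝ)).prodMk (hasDerivAt_const (0 : ℝ) t)
  have h2 := (((contDiff_pushOffVec (p := p) (i := i) hb).differentiable (by simp)
    (0, t)).hasFDerivAt).comp_hasDerivAt (0 : ℝ) h1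
  have h3 : HasDerivAt (fun u : ℝ => (hopfExp p t, (u : ℂ) * (hopfExp p t * b t)))
      ((0 : ℂ), hopfExp p t * b t) 0 := by
    have := ((hasDerivAt_id (0 : ℝ)).ofReal_comp).mul_const (hopfExp p t * b t)
    exact (hasDerivAt_const (0 : ℝ) (hopfExp p t)).prodMk (by simpa using this)
  have h4 := (pair i).hasFDerivAt.comp_hasDerivAt (0 : ℝ) h3
  exact h2.unique h4

theorem pushOffVec_add_one {i : Fin 2} {b : ℝ → ℂ} (hb : ∀ t, b (t + 1) = b t) (s t : ℝ) :
    pushOffVec p i b (s, t + 1) =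
      Complex.exp (2 * Real.pi * Complex.I / p) • pushOffVec p i b (s, t) := by
  rw [pushOffVec, pushOffVec, smul_pair]
  simp only [hopfExp_add_one, hb]
  congr 2
  ring

variable [NeZero p] {φ : LensSpace p ≃ₘ^∞⟮𝓡 3, 𝓡 3⟯ LensSpace p}

/-- The pairing of a smooth `1`-form with a partial derivative of a smooth map is smooth. -/
theorem contDiff_pairing {α : ∀ x : LensSpace p, TangentSpace (𝓡 3) x →L[ℝ] ℝ}
    (hα : ∀ x, ContDiffOn ℝ ∞ (localForm α x) (chartAt (EuclideanSpace ℝ (Fin 3)) x).target)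
    {G : ℝ × ℝ → LensSpace p} (hG : ContMDiff 𝓘(ℝ, ℝ × ℝ) (𝓡 3) ∞ G) :
    ContDiff ℝ ∞ fun t : ℝ =>
      α (G (0, t)) (mfderiv 𝓘(ℝ, ℝ × ℝ) (𝓡 3) G (0, t) ((1, 0) : ℝ × ℝ)) := by
  rw [contDiff_iff_contDiffAt]
  intro t₀
  set e := chartAt (EuclideanSpace ℝ (Fin 3)) (G (0, t₀)) with he
  have hmem : G (0, t₀) ∈ e.source := mem_chart_source _ _
  have hes : ∀ x ∈ e.source, ContMDiffAt (𝓡 3) (𝓡 3) ∞ e x := fun x hx =>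
    (contMDiffOn_chart (I := 𝓡 3) (n := ∞) (x := G (0, t₀))).contMDiffAt (e.open_source.mem_nhds hx)
  have het : ∀ y ∈ e.target, ContMDiffAt (𝓡 3) (𝓡 3) ∞ e.symm y := fun y hy =>
    (contMDiffOn_chart_symm (I := 𝓡 3) (n := ∞) (x := G (0, t₀))).contMDiffAt
      (e.open_target.mem_nhds hy)
  set g : ℝ × ℝ → EuclideanSpace ℝ (Fin 3) := fun x => e (G x) with hg
  have hgs : ∀ x, G x ∈ e.source → ContDiffAt ℝ ∞ g x := fun x hx =>
    (ContMDiffAt.comp x (hes _ hx) (hG x)).contDiffAt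
  have hline : ContDiff ℝ ∞ fun t : ℝ => ((0, t) : ℝ × ℝ) := contDiff_const.prodMk contDiff_id
  have h1 : ContDiffAt ℝ ∞ (fun t : ℝ => localForm α (G (0, t₀)) (g (0, t))
      (fderiv ℝ g (0, t) (1, 0))) t₀ := by
    exact contDiffAt_pairing (hgs (0, t₀) hmem) ((hα (G (0, t₀))).contDiffAt
      (e.open_target.mem_nhds (e.map_source hmem)))
  refine h1.congr_of_eventuallyEq ?_
  have hopen : ∀ᶠ t in nhds t₀, G (0, t) ∈ e.source :=
    (hG.continuous.comp hline.continuous).continuousAt.eventually (e.open_source.mem_nhds hmem)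
  filter_upwards [hopen] with t ht
  -- Near (0, t) the map factors through the chart, so the chain rule compares its partial
  -- derivative with that of g.
  have h5 : e.symm ∘ g =ᶠ[nhds (0, t)] G := by
    filter_upwards [hG.continuous.continuousAt.eventually (e.open_source.mem_nhds ht)] with x hx
    exact e.left_inv hx
  have h6 : (mfderiv 𝓘(ℝ, ℝ × ℝ) (𝓡 3) G (0, t) ((1, 0) : ℝ × ℝ) : EuclideanSpace ℝ (Fin 3)) =
      mfderiv (𝓡 3) (𝓡 3) e.symm (g (0, t)) (fderiv ℝ g (0, t) (1, 0)) := by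
    rw [← h5.mfderiv_eq, ← mfderiv_eq_fderiv]
    exact mfderiv_comp_apply ((0, t) : ℝ × ℝ)
      ((het _ (e.map_source ht)).mdifferentiableAt (by simp))
      ((hgs _ ht).contMDiffAt.mdifferentiableAt (by simp)) ((1, 0) : ℝ × ℝ)
  have h7 : e.symm (g (0, t)) = G (0, t) := e.left_inv ht
  have key : ∀ (x x' : LensSpace p) (v v' : EuclideanSpace ℝ (Fin 3)), x = x' → v = v' →
      (α x v : ℝ) = α x' v' := by
    rintro x _ v _ rfl rfl; rfl
  exact key _ _ _ _ h7.symm h6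

variable (φ) in
/-- The push-off of a component of a Hopf link along a normal vector field. -/
def pushOffMap (i : Fin 2) {b : ℝ → ℂ} (hb : ContDiff ℝ ∞ b) :
    C^∞⟮𝓘(ℝ, ℝ × ℝ), ℝ × ℝ; 𝓡 3, LensSpace p⟯ :=
  ⟨fun x => φ (proj p (toS3 (pushOffVec p i b) (pushOffVec_ne_zero p i b) x)),
    (isLocalDiffeomorph_comp_proj φ).contMDiff.comp (contMDiff_toS3 (contDiff_pushOffVec hb) _)⟩

theorem pushOffMap_zero {i : Fin 2} {b : ℝ → ℂ} (hb : ContDiff ℝ ∞ b) (t : ℝ) :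
    pushOffMap φ i hb (0, t) = φ (proj p (hopfPoint p i t)) :=
  congrArg (fun y => φ (proj p y)) (toS3_eq (pushOffVec_zero i b t))

theorem pushOffMap_add_one {i : Fin 2} {b : ℝ → ℂ} (hb : ContDiff ℝ ∞ b)
    (hb1 : ∀ t, b (t + 1) = b t) (s t : ℝ) :
    pushOffMap φ i hb (s, t + 1) = pushOffMap φ i hb (s, t) := by
  have hp : (p : ℂ) ≠ 0 := NeZero.ne _
  have h0 := norm_pos_iff.2 (pushOffVec_ne_zero p i b (s, t))
  have h1 := norm_pos_iff.2 (pushOffVec_ne_zero p i b (s, t + 1))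
  refine congrArg φ (proj_eq_proj (s := ‖pushOffVec p i b (s, t + 1)‖⁻¹ * ‖pushOffVec p i b (s, t)‖)
    (ρ := Complex.exp (2 * Real.pi * Complex.I / p)) (by positivity) ?_ ?_)
  · rw [← Complex.exp_nat_mul, mul_div_cancel₀ _ hp, Complex.exp_two_pi_mul_I]
  · have : (‖pushOffVec p i b (s, t)‖ : ℂ) ≠ 0 := by exact_mod_cast h0.ne'
    rw [coe_toS3, coe_toS3, smul_smul]
    conv_lhs => rw [pushOffVec_add_one hb1 s t, smul_smul]
    congr 1
    rw [← pushOffVec_add_one hb1]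
    push_cast
    field_simp

theorem mfderiv_pushOffMap {i : Fin 2} {b : ℝ → ℂ} (hb : ContDiff ℝ ∞ b) (t : ℝ) :
    (mfderiv 𝓘(ℝ, ℝ × ℝ) (𝓡 3) (pushOffMap φ i hb) (0, t) ((1, 0) : ℝ × ℝ) :
      EuclideanSpace ℝ (Fin 3)) =
      pushVec φ (hopfPoint p i t) (pair i (0, hopfExp p t * b t)) :=
  mfderiv_comp_toS3 φ (contDiff_pushOffVec hb) _ (pushOffVec_zero i b t) ((1, 0) : ℝ × ℝ)
    (fderiv_pushOffVec hb t) (inner_axisPoint_zero i _ _)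

theorem pushOffMap_ne {i : Fin 2} {K : Curve p} (hK : ∀ t, K t = φ (standardHopf p i t))
    {b : ℝ → ℂ} (hb : ContDiff ℝ ∞ b) (hb0 : ∀ t, b t ≠ 0) {s : ℝ} (hs : s ≠ 0) (t t' : ℝ) :
    pushOffMap φ i hb (s, t) ≠ K t' := by
  intro h
  have h1 : proj p (toS3 (pushOffVec p i b) (pushOffVec_ne_zero p i b) (s, t)) =
      standardHopf p i t' := φ.injective (h.trans (hK t'))
  have h2 := coordPow_rev_standardHopf (p := p) i t'
  rw [← h1, coordPow_eq_zero, coe_toS3, PiLp.smul_apply, smul_eq_zero] at h2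
  rcases h2 with h2 | h2
  · simp [pushOffVec_ne_zero] at h2
  · simp [pushOffVec, hb0, hs] at h2

variable (φ) in
/-- The restriction of a `1`-form to the normal plane of a component of a Hopf link. -/
def normalForm (α : ∀ x : LensSpace p, TangentSpace (𝓡 3) x →L[ℝ] ℝ) (i : Fin 2) (t : ℝ) :
    ℂ →ₗ[ℝ] ℝ :=
  { toFun := fun b => α (φ (proj p (hopfPoint p i t)))
      (pushVec φ (hopfPoint p i t) (pair i (0, hopfExp p t * b)))
    map_add' := fun b b' => by
      rw [← map_add, ← map_add, ← map_add, Prod.mk_add_mk, add_zero, mul_add]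
    map_smul' := fun r b => by
      rw [RingHom.id_apply, ← map_smul, ← map_smul, ← map_smul, Prod.smul_mk, smul_zero,
        mul_smul_comm] }

theorem form_congr (α : ∀ x : LensSpace p, TangentSpace (𝓡 3) x →L[ℝ] ℝ) {x x' : LensSpace p}
    (hx : x = x') {v v' : EuclideanSpace ℝ (Fin 3)} (hv : v = v') : (α x v : ℝ) = α x' v' := by
  subst hx hv; rfl

/-- The form kills the velocity, so only the normal component of v matters. The factor `hopfExp` in
`normalForm` undoes the rotation in `crossDeriv`. -/
theorem form_eq_normalForm {α : ∀ x : LensSpace p, TangentSpace (𝓡 3) x →L[ℝ] ℝ} {i : Fin 2}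
    {K : Curve p} (hK : ∀ t, K t = φ (standardHopf p i t)) {t : ℝ}
    (hLeg : α (K t) (velocity K t) = 0) (v : EuclideanSpace ℝ (Fin 3)) :
    (α (K t) v : ℝ) = normalForm φ α i t (crossDeriv φ i (K t) v) := by
  obtain ⟨r, b, hv, hb⟩ := exists_eq_velocity_add hK t v
  have hKt : K t = φ (proj p (hopfPoint p i t)) := by rw [hK, standardHopf_eq]
  rw [hb, ← hopfExp_eq]
  change _ = α _ (pushVec φ (hopfPoint p i t)
    (pair i (0, hopfExp p t * ((starRingEnd ℂ) (hopfExp p t) * b))))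
  rw [conj_hopfExp_mul]
  have h1 : (α (K t) v : ℝ) = r * α (K t) (velocity K t) +
      α (K t) (toModel (pushVec φ (hopfPoint p i t) (pair i (0, b)))) := by
    conv_lhs => rw [hv]
    exact (map_add (α (K t)) _ _).trans (congrArg₂ (· + ·) (map_smul (α (K t)) _ _) rfl)
  rw [h1, hLeg, mul_zero, zero_add]
  exact form_congr α hKt rfl

/-- The pairing is that of α with the initial velocity of the push-off along the constant normal
field b. Smoothness and periodicity come from those of this push-off. -/
theorem contDiff_normalForm {α : ∀ x : LensSpace p, TangentSpace (𝓡 3) x →L[ℝ] ℝ}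
    (hα : ∀ x, ContDiffOn ℝ ∞ (localForm α x) (chartAt (EuclideanSpace ℝ (Fin 3)) x).target)
    (i : Fin 2) (b : ℂ) :
    ContDiff ℝ ∞ (fun t => normalForm φ α i t b) ∧
      ∀ t, normalForm φ α i (t + 1) b = normalForm φ α i t b := by
  have hb : ContDiff ℝ ∞ fun _ : ℝ => b := contDiff_const
  have heq : ∀ t, normalForm φ α i t b = α (pushOffMap φ i hb (0, t))
      (mfderiv 𝓘(ℝ, ℝ × ℝ) (𝓡 3) (pushOffMap φ i hb) (0, t) ((1, 0) : ℝ × ℝ)) := fun t =>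
    form_congr α (pushOffMap_zero hb t).symm (mfderiv_pushOffMap hb t).symm
  have hper := pushOffMap_add_one (φ := φ) (i := i) hb (fun _ => rfl)
  refine ⟨?_, fun t => ?_⟩
  · simp only [heq]
    exact contDiff_pairing hα (pushOffMap φ i hb).contMDiff
  · rw [heq, heq]
    refine form_congr α (hper 0 t) ?_
    have h1 : (pushOffMap φ i hb : ℝ × ℝ → LensSpace p) ∘ (fun x : ℝ × ℝ => x + (0, 1)) =
        pushOffMap φ i hb := by
      funext ⟨a, b⟩; simpa using hper a b
    have h2 := mfderiv_comp_apply (I := 𝓘(ℝ, ℝ × ℝ)) (I' := 𝓘(ℝ, ℝ × ℝ)) ((0, t) : ℝ × ℝ)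
      (g := pushOffMap φ i hb) (f := fun x : ℝ × ℝ => x + (0, 1))
      ((pushOffMap φ i hb).contMDiff.mdifferentiableAt (by simp))
      ((differentiableAt_id.add_const _).mdifferentiableAt) ((1, 0) : ℝ × ℝ)
    rw [h1] at h2
    have h3 : (mfderiv 𝓘(ℝ, ℝ × ℝ) 𝓘(ℝ, ℝ × ℝ) (fun x : ℝ × ℝ => x + (0, 1)) (0, t)
        ((1, 0) : ℝ × ℝ) : ℝ × ℝ) = (1, 0) := by
      rw [mfderiv_eq_fderiv, fderiv_add_const, fderiv_fun_id]
      rfl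
    have h4 : ((0, t + 1) : ℝ × ℝ) = (0, t) + (0, 1) := by simp
    refine Eq.trans ?_ h2.symm
    refine (congrArg (fun x => toModel (mfderiv 𝓘(ℝ, ℝ × ℝ) (𝓡 3) (pushOffMap φ i hb) x
      ((1, 0) : ℝ × ℝ))) h4).trans ?_
    exact congrArg (mfderiv 𝓘(ℝ, ℝ × ℝ) (𝓡 3) (pushOffMap φ i hb) ((0, t) + (0, 1))) h3.symm

end

/-! ### Existence of contact push-offs and uniqueness of the framing -/

section

variable {p : ℕ} [NeZero p] {φ : LensSpace p ≃ₘ^∞⟮𝓡 3, 𝓡 3⟯ LensSpace p}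

/-- Nonvanishing is stated for chart expressions; it passes to the form itself, of which they are
pullbacks. -/
theorem IsContactForm.ne_zero {α : ∀ x : LensSpace p, TangentSpace (𝓡 3) x →L[ℝ] ℝ}
    (hα : IsContactForm α) (x : LensSpace p) : ∃ v : EuclideanSpace ℝ (Fin 3), (α x v : ℝ) ≠ 0 := by
  set e := chartAt (EuclideanSpace ℝ (Fin 3)) x with he
  have hx : x ∈ e.source := mem_chart_source _ x
  have h := ((hα x).2 (e x) (e.map_source hx)).1
  by_contra! h0
  refine h (ContinuousLinearMap.ext fun v => ?_)
  exact (form_congr α (e.left_inv hx) (v' := mfderiv (𝓡 3) (𝓡 3) e.symm (e x) v) rfl).trans (h0 _)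

theorem normalForm_ne_zero {α : ∀ x : LensSpace p, TangentSpace (𝓡 3) x →L[ℝ] ℝ}
    (hα : IsContactForm α) {i : Fin 2} {K : Curve p} (hK : ∀ t, K t = φ (standardHopf p i t))
    (hLeg : ∀ t, α (K t) (velocity K t) = 0) (t : ℝ) : normalForm φ α i t ≠ 0 := by
  intro h
  obtain ⟨v, hv⟩ := hα.ne_zero (K t)
  rw [form_eq_normalForm hK (hLeg t) v, h] at hv
  exact hv rfl

/-- There is a smooth periodic vector field along a Legendrian link component that is tangent to
the contact structure and normal to the component. -/
theorem exists_normal_field {α : ∀ x : LensSpace p, TangentSpace (𝓡 3) x →L[ℝ] ℝ}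
    (hα : IsContactForm α) {i : Fin 2} {K : Curve p} (hK : ∀ t, K t = φ (standardHopf p i t))
    (hLeg : ∀ t, α (K t) (velocity K t) = 0) :
    ∃ b : ℝ → ℂ, ContDiff ℝ ∞ b ∧ (∀ t, b (t + 1) = b t) ∧ (∀ t, b t ≠ 0) ∧
      ∀ t, normalForm φ α i t (b t) = 0 := by
  have h1 := contDiff_normalForm (φ := φ) (fun x => (hα x).1) i 1
  have hI := contDiff_normalForm (φ := φ) (fun x => (hα x).1) i Complex.I
  have hdec : ∀ t (z : ℂ), normalForm φ α i t z =
      z.re * normalForm φ α i t 1 + z.im * normalForm φ α i t Complex.I := fun t z => by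
    have h : z = z.re • (1 : ℂ) + z.im • Complex.I := by simp
    conv_lhs => rw [h, map_add, map_smul, map_smul, smul_eq_mul, smul_eq_mul]
  -- A functional z ↦ β(1) Re z + β(i) Im z on ℂ is killed by -β(i) + β(1) i, which depends smoothly
  -- on β and vanishes only with it.
  refine ⟨fun t => -(normalForm φ α i t Complex.I : ℂ) + normalForm φ α i t 1 * Complex.I,
    ?_, fun t => ?_, fun t h0 => ?_, fun t => ?_⟩
  · exact (Complex.ofRealCLM.contDiff.comp hI.1).neg.add
      ((Complex.ofRealCLM.contDiff.comp h1.1).mul contDiff_const)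
  · simp only [h1.2, hI.2]
  · have hre : normalForm φ α i t Complex.I = 0 := by simpa using congrArg Complex.re h0
    have him : normalForm φ α i t 1 = 0 := by simpa using congrArg Complex.im h0
    exact normalForm_ne_zero hα hK hLeg t (LinearMap.ext fun z => by rw [hdec, hre, him]; simp)
  · rw [hdec]
    simp
    ring

theorem exists_contactPushOff {α : ∀ x : LensSpace p, TangentSpace (𝓡 3) x →L[ℝ] ℝ}
    (hα : IsContactForm α) {ξ : ∀ x : LensSpace p, Submodule ℝ (TangentSpace (𝓡 3) x)}
    (hξ : ∀ x v, v ∈ ξ x ↔ α x v = 0) {i : Fin 2} {K : Curve p}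
    (hK : ∀ t, K t = φ (standardHopf p i t)) (hLeg : IsLegendrian ξ K) :
    ∃ K' : Curve p, IsContactPushOff ξ K K' := by
  obtain ⟨b, hb, hb1, hb0, hbker⟩ :=
    exists_normal_field hα hK fun t => (hξ _ _).1 (hLeg t)
  have hline : ContMDiff 𝓘(ℝ, ℝ) 𝓘(ℝ, ℝ × ℝ) ∞ fun t : ℝ => ((1, t) : ℝ × ℝ) :=
    (contDiff_const.prodMk contDiff_id).contMDiff
  refine ⟨⟨fun t => pushOffMap φ i hb (1, t), (pushOffMap φ i hb).contMDiff.comp hline⟩,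
    pushOffMap φ i hb, pushOffMap_add_one hb hb1, fun t => ?_, fun t => ?_, fun t => ?_,
    fun s t t' hs _ => pushOffMap_ne hK hb hb0 hs.ne' t t', fun t => rfl⟩
  · rw [pushOffMap_zero, hK, standardHopf_eq]
  · rw [hξ]
    exact (form_congr α (pushOffMap_zero hb t) (mfderiv_pushOffMap hb t)).trans (hbker t)
  · refine LinearIndependent.pair_iff.2 fun r s h => ?_
    have hv := velocity_eq hK t
    have hd := mfderiv_pushOffMap (φ := φ) (i := i) hb t
    have h1 : pushVec φ (hopfPoint p i t)
        (pair i (((r * (2 * Real.pi / p) : ℝ) : ℂ) * Complex.I * Circle.exp (2 * Real.pi * t / p),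
          s * (hopfExp p t * b t))) = 0 := by
      have h2 : pair i (((r * (2 * Real.pi / p) : ℝ) : ℂ) * Complex.I *
          Circle.exp (2 * Real.pi * t / p), s * (hopfExp p t * b t)) =
          r • pair i ((2 * Real.pi / p : ℝ) * Complex.I * Circle.exp (2 * Real.pi * t / p), 0) +
          s • pair i (0, hopfExp p t * b t) := by
        rw [← map_smul, ← map_smul, ← map_add]
        congr 1
        ext1
        · simp; ring
        · simp
      rw [h2, map_add, map_smul, map_smul]
      refine Eq.trans ?_ h
      rw [hv, hd]
      rfl
    -- On tangent vectors of the sphere `pushVec` is injective, and the two vectors lie in different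
    -- coordinate axes of ℂ².
    have h2 := pushVec_injOn φ (inner_axisPoint i _ _ _) h1
    constructor
    · have := congrArg (fun v : C2 => v i) h2
      simpa [NeZero.ne p, Real.pi_ne_zero] using this
    · have := congrArg (fun v : C2 => v i.rev) h2
      simpa [hb0 t] using this

/-- The framing functions of two contact push-offs have the same winding number. -/
theorem HasWinding.of_normalForm {β : ℝ → ℂ →ₗ[ℝ] ℝ} (hβ : ∀ t, β t ≠ 0) {c c' : ℝ → ℂ}
    (hc : Continuous c) (hc' : Continuous c') (h1 : c 1 = c 0) (h1' : c' 1 = c' 0)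
    (h0' : ∀ t, c' t ≠ 0) (hker : ∀ t, β t (c t) = 0)
    (hker' : ∀ t, β t (c' t) = 0) {m : ℤ} (hm : HasWinding c m) : HasWinding c' m := by
  have hre : ∀ t, c' t = ((c' t / c t).re : ℂ) * c t := fun t => by
    obtain ⟨r, hr⟩ := exists_real_mul_of_ker (hβ t) (hker t) (hker' t) (hm.ne_zero t)
    rw [hr, mul_div_cancel_right₀ _ (hm.ne_zero t), Complex.ofReal_re]
  -- The ratio of two nonzero vectors on the same real line is real, and it depends continuously on
  -- t.
  have := hm.real_mul (c := fun t => (c' t / c t).re)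
    (Complex.continuous_re.comp (hc'.div hc hm.ne_zero))
    (fun t h => h0' t (by rw [hre, h]; simp)) (by simp only [h1, h1'])
  convert this using 2 with t
  exact hre t

end

end LensHopf

end

/-! ### The theorem: existence, independence of choices and value in one equivalence -/

theorem mainTheorem3 (p : ℕ) [NeZero p]
    (ξ : ∀ x : LensHopf.LensSpace p, Submodule ℝ (TangentSpace (𝓡 3) x))
    (hξ : LensHopf.IsContactStructure ξ)
    (L : Fin 2 → LensHopf.Curve p) (hL : LensHopf.IsHopfLink p L)
    (i : Fin 2) (hLeg : LensHopf.IsLegendrian ξ (L i)) :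
    ∃ t : ℤ, ∀ q : ℚ, LensHopf.IsRationalTB ξ (L i) q ↔ q = (t : ℚ) + 1 / (p : ℚ) := by
  obtain ⟨α, hα, hker⟩ := hξ
  obtain ⟨φ, hφ, hφL⟩ := hL
  have hK := hφL i
  have hLeg' : ∀ t, α (L i t) (LensHopf.velocity (L i) t) = 0 := fun t => (hker _ _).1 (hLeg t)
  have hp : (p : ℚ) ≠ 0 := NeZero.ne _
  -- the framing function of a push-off
  have key : ∀ L', LensHopf.IsContactPushOff ξ (L i) L' → L' 1 = L' 0 ∧
      ∃ c : ℝ → ℂ, Continuous c ∧ c 1 = c 0 ∧ (∀ t, c t ≠ 0) ∧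
        (∀ t, LensHopf.normalForm φ α i t (c t) = 0) ∧ ∀ m, LensHopf.HasWinding c m →
          LensHopf.HasWinding (fun t => LensHopf.coordPow p i.rev (φ.symm (L' t))) (p * m + 1) := by
    rintro L' ⟨F, hper, hF0, htan, hli, hdisj, hF1⟩
    obtain ⟨c, hc, h1, h0, hcv, hw⟩ := LensHopf.hasWinding_pushOff hK hper hF0 hli hdisj
    refine ⟨by rw [hF1, hF1]; simpa using hper 1 0, c, hc, h1, h0, fun t => ?_, ?_⟩
    · rw [hcv]
      refine (LensHopf.form_eq_normalForm hK (hLeg' t) _).symm.trans ?_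
      exact (LensHopf.form_congr α (hF0 t).symm rfl).trans ((hker _ _).1 (htan t))
    · simpa only [hF1] using hw
  obtain ⟨L₀, hL₀⟩ := LensHopf.exists_contactPushOff hα hker hK hLeg
  obtain ⟨hL₀1, c₀, hc₀, h1₀, h0₀, hker₀, hw₀⟩ := key L₀ hL₀
  obtain ⟨m, hm⟩ := LensHopf.HasWinding.exists_of_eq hc₀ h0₀ h1₀
  -- Winding number pm + 1 divided by p; the integer of the theorem is the winding number m of the
  -- framing function.
  have hval : (((p * m + 1 : ℤ) : ℚ)) / p = m + 1 / p := by
    push_cast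
    field_simp
  refine ⟨m, fun q => ⟨?_, ?_⟩⟩
  · rintro ⟨L', hL', hq⟩
    obtain ⟨hL'1, c, hc, h1, h0, hkerc, hw⟩ := key L' hL'
    -- The framing functions of the given push-off and of `L₀` lie in the same kernel lines, so they
    -- have the same winding number m.
    have hcm := LensHopf.HasWinding.of_normalForm
      (LensHopf.normalForm_ne_zero hα hK hLeg') hc₀ hc h1₀ h1 h0 hker₀ hkerc hm
    rw [← hval]
    exact (LensHopf.isRationalLinkingNumber_iff hφ hK hL'1 (hw m hcm) q).1 hq
  · rintro rfl
    exact ⟨L₀, hL₀, (LensHopf.isRationalLinkingNumber_iff hφ hK hL₀1 (hw₀ m hm) _).2 hval.symm⟩
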